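/- \textbf{Setting.} An event $e=(\mathit{id},\mathit{parents},\mathit{op})$ consists of an ID, a finite set of parent IDs, and an operation $\mathit{Insert}(i,c)$ or $\mathit{Delete}(i)$ (zero-based index). In a finite event graph $G$, $a\to b$ ($a$ happened before $b$) means that there is a directed parent-to-child path from $a$ to $b$. For a set $V$ of IDs (a version), $\mathsf{Events}(V)$ is the set of the events with ID in $V$ and of all events that happened before one of them; $\mathsf{Version}(H)$ is the set of IDs of the events of $H$ that happened before no other event of $H$. $V$ is critical in $G$ if every event of $\mathsf{Events}(V)$ happened before every event of $G\setminus\mathsf{Events}(V)$. $G$ is valid if IDs are unique, every parent ID is the ID of another event of $G$, the graph is acyclic, and the index of each operation exists in the document obtained by replaying $\mathsf{Events}(e.\mathit{parents})$. \textbf{Replay} (Eg-walker). The events are processed in a topological sort order, starting with the empty document and the empty internal state. The internal state is a sequence of records, a map from the IDs of the processed events to the record that each of them inserted or deleted, and a prepare version $V_p$. A record has an ID, its left and right origins, a logical timestamp (the number of events that happened before the insertion event, plus one), a state $s_p\in\{\texttt{NotInsertedYet},\texttt{Ins},\texttt{Del }1,\texttt{Del }2,\dots\}$ in the prepare version and a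 state $s_e\in\{\texttt{Ins},\texttt{Del}\}$ in the effect version. To process $e$, the prepare version is moved to $e.\mathit{parents}$: events in $\mathsf{Events}(V_p)\setminus\mathsf{Events}(e.\mathit{parents})$ are retreated and events in $\mathsf{Events}(e.\mathit{parents})\setminus\mathsf{Events}(V_p)$ are advanced, which moves $s_p$ of the affected record one step back or forth along $\texttt{NotInsertedYet},\texttt{Ins},\texttt{Del }1,\texttt{Del }2,\dots$. Then $e$ is applied, and the prepare version becomes $\{e.\mathit{id}\}$. An insertion $\mathit{Insert}(i,c)$ creates a record with $s_p=s_e=\texttt{Ins}$; its left origin is the $i$-th record with $s_p=\texttt{Ins}$ (the start if $i=0$), its right origin is the next record with $s_p\ne\texttt{NotInsertedYet}$ (or the end), and its position is determined by a list CRDT. A deletion $\mathit{Delete}(i)$ takes the record at zero-based index $i$ among those with $s_p=\texttt{Ins}$, sets $s_p=\texttt{Del }1$ and $s_e=\texttt{Del}$. The transformed operation, which is applied to the document, has as its index the number of records with $s_e=\texttt{Ins}$ before the affected record; a deletion is a no-op if the record already had $s_e=\texttt{Del}$. The document is kept as a sequence of pairs (ID of the inserting event, character). Whenever the version of the events processed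 so far is critical in $G$, the internal state may be discarded and replaced by a placeholder, which behaves like one record with $s_p=s_e=\texttt{Ins}$ for each character of the document; this is done at those critical versions that satisfy a predicate $D$ (for instance always, or never). A list CRDT is a rule that gives the position of a new record from the current sequence of records (their IDs, origins and timestamps) and the new record's ID, origins and timestamp. It is convergent if integrating the same set of insertions (each generated between two neighbouring elements of the sequence that results from the insertions that happened before it) in any two orders that respect causality gives the same sequence. \textbf{Lemma.} Let the list CRDT be any convergent one, or RGA (insert after the left origin and after the run of records with greater (timestamp, ID) that follows it). Let $D$ be any predicate on versions and $G$ any valid event graph. Then $\mathsf{replay}(G)$ is deterministic: a topological sort order of $G$ exists, and any two topological sort orders of $G$ lead to the same document state and to the same internal state, where the two internal states are compared after moving the prepare version of both to the same version $V$ of $G$, for every set $V$ of IDs of events of $G$. Hence replicas with the same event graph converge. -/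

import Mathlib

namespace EgWalker

/-! ## Events and event graphs -/

/-- Index-based operations on a sequence of characters from `α` (indexes start at 0). -/
inductive Op (α : Type*) where
  | insert (i : ℕ) (c : α)
  | delete (i : ℕ)

/-- The index of the operation exists in a document of length `n`. -/
def Op.IndexExists {α : Type*} (n : ℕ) : Op α → Prop
  | .insert i _ => i ≤ n
  | .delete i => i < n

/-- An event: a unique ID, the set of the IDs of its parents, and an operation. -/
structure Event (ID α : Type*) where
  id : ID
  parents : Finset ID
  op : Op α

variable {ID α : Type*}

/-- `a` happened before `b` in the graph `G`: there is a directed path from `a` to `b`. -/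
def HappenedBefore (G : Finset (Event ID α)) : Event ID α → Event ID α → Prop :=
  Relation.TransGen fun a b => a ∈ G ∧ b ∈ G ∧ a.id ∈ b.parents

open Classical in
/-- The set of events of `G` that a version (set of event IDs) stands for: the events with an ID in
`V`, and all events that happened before one of them. -/
noncomputable def events (G : Finset (Event ID α)) (V : Finset ID) : Finset (Event ID α) :=
  {e ∈ G | e.id ∈ V ∨ ∃ v ∈ G, v.id ∈ V ∧ HappenedBefore G e v}

open Classical in
/-- The version of a graph: the set of the IDs of its frontier. -/
noncomputable def version (G : Finset (Event ID α)) : Finset ID :=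
  {e ∈ G | ¬ ∃ e' ∈ G, HappenedBefore G e e'}.image Event.id

/-- `V` is a critical version of `G`: all events in `events G V` happened before all others. -/
def IsCritical (G : Finset (Event ID α)) (V : Finset ID) : Prop :=
  ∀ a ∈ events G V, ∀ b ∈ G, b ∉ events G V → HappenedBefore G a b

/-- `E` lists every event of `G` exactly once, and no event stands before one that happened
before it. -/
structure IsTopologicalSort (G : Finset (Event ID α)) (E : List (Event ID α)) : Prop where
  nodup : E.Nodup
  mem_iff : ∀ e, e ∈ E ↔ e ∈ G
  causal : E.Pairwise fun a b => ¬ HappenedBefore G b a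

/-! ## List CRDTs, which order concurrent insertions -/

/-- IDs of records: either the record was created by the insertion event with ID `i`, or it is the
`k`-th character of the placeholder that replaces a discarded internal state. -/
inductive RecordId (ID : Type*) where
  | ins (i : ID)
  | placeholder (k : ℕ)
deriving DecidableEq

/-- The immutable part of a record, from which a list CRDT determines the order of records.
An origin `none` is the start (left) or the end (right) of the sequence. The `stamp` is a logical
timestamp: the number of events known at the generation of the insertion event, itself included
(the sum of the entries of its vector clock). -/
structure Item (ID : Type*) where
  id : RecordId ID
  originLeft : Option (RecordId ID)
  originRight : Option (RecordId ID)
  stamp : ℕ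

/-- The sequence of items that represents `n` characters as a placeholder. -/
def placeholderItems (ID : Type*) (n : ℕ) : List (Item ID) :=
  (List.range n).map fun k => ⟨.placeholder k, none, none, 0⟩

/-- Insertion of `x` before position `q` of a list (at its end if `q` is too large). -/
def insertAt {β : Type*} (q : ℕ) (x : β) (l : List β) : List β :=
  l.take q ++ x :: l.drop q

/-- The insertion rule of a list CRDT: given the current sequence of items and a new item, the
position at which the new item is inserted. -/
abbrev ListCRDT (ID : Type*) := List (Item ID) → Item ID → ℕ

namespace ListCRDT

/-- The sequence that results from integrating, one after the other, the insertions with IDs in `L`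
into a placeholder of length `n`; `msg i` is the item of the insertion with ID `i`. -/
def build (crdt : ListCRDT ID) (n : ℕ) (msg : ID → Item ID) (L : List ID) : List (Item ID) :=
  L.foldl (fun s i => insertAt (crdt s (msg i)) (msg i) s) (placeholderItems ID n)

/-- `L` is an order, compatible with causality, in which the insertions in `S` can be delivered. -/
structure IsCausalOrder (hb : ID → ID → Prop) (S : Set ID) (L : List ID) : Prop where
  nodup : L.Nodup
  mem_iff : ∀ i, i ∈ L ↔ i ∈ S
  causal : L.Pairwise fun i j => ¬ hb j i

/-- `S` is a finite set of insertions that replicas can generate with the list CRDT `crdt`, starting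
from `n` characters that are known to all of them, where `hb` is the happened-before relation:
each insertion takes place between two adjacent elements of the sequence that results from
integrating the insertions that happened before it. -/
structure IsHistory (crdt : ListCRDT ID) (n : ℕ) (S : Finset ID) (hb : ID → ID → Prop)
    (msg : ID → Item ID) : Prop where
  hb_irrefl : ∀ i, ¬ hb i i
  hb_trans : ∀ i j k, hb i j → hb j k → hb i k
  id_eq : ∀ i ∈ S, (msg i).id = .ins i
  stamp_pos : ∀ i ∈ S, 0 < (msg i).stamp
  stamp_lt : ∀ i ∈ S, ∀ j ∈ S, hb i j → (msg i).stamp < (msg j).stamp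
  origins : ∀ i ∈ S, ∃ L, IsCausalOrder hb {j | j ∈ S ∧ hb j i} L ∧
    ∃ l₁ l₂, crdt.build n msg L = l₁ ++ l₂ ∧
      (msg i).originLeft = l₁.getLast?.map Item.id ∧
      (msg i).originRight = l₂.head?.map Item.id

/-- The defining property of a list CRDT, as a data type of its own: replicas that integrate the
same insertions, in any orders that respect causality, have the same sequence. -/
def IsConvergent (crdt : ListCRDT ID) : Prop :=
  ∀ (n : ℕ) (S : Finset ID) (hb : ID → ID → Prop) (msg : ID → Item ID),
    IsHistory crdt n S hb msg → ∀ L L', IsCausalOrder hb S L → IsCausalOrder hb S L' →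
      crdt.build n msg L = crdt.build n msg L'

/-- The order of timestamps in RGA: by the logical timestamp, and then by the ID of the event. -/
def rgaLess [LinearOrder ID] (x y : Item ID) : Bool :=
  decide (x.stamp < y.stamp) || (decide (x.stamp = y.stamp) &&
    match x.id, y.id with
    | .ins i, .ins j => decide (i < j)
    | _, _ => false)

/-- The Replicated Growable Array (RGA): the new item goes to the right of its left origin, after
the run of items with greater timestamps that follows there. -/
def rga [LinearOrder ID] : ListCRDT ID := fun s x =>
  let start := match x.originLeft with
    | none => 0
    | some l => s.findIdx (fun y => decide (y.id = l)) + 1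
  start + ((s.drop start).takeWhile (rgaLess x)).length

end ListCRDT

/-! ## The internal state -/

/-- A record of the internal state. The state of the character in the prepare version is `sp`:
0 is "not inserted yet", 1 is "inserted", and `n + 1` is "deleted by `n` events". The state in the
effect version is `deleted`: `false` is "inserted" and `true` is "deleted". -/
structure Record (ID : Type*) where
  item : Item ID
  sp : ℕ
  deleted : Bool

/-- The internal state: the sequence of records, the map from (the IDs of) the events applied so far
to the record that the event inserted or deleted, and the prepare version. -/
structure State (ID : Type*) where
  records : List (Record ID)
  target : ID → Option (RecordId ID)
  prepare : Finset ID

namespace State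

/-- The internal state before any event, or after discarding the internal state at the version `V`
with a document of length `n`: one placeholder, which is a sequence of inserted records. -/
def ofPlaceholder (V : Finset ID) (n : ℕ) : State ID where
  records := (placeholderItems ID n).map fun x => ⟨x, 1, false⟩
  target := fun _ => none
  prepare := V

/-- Update of `sp` in the record affected by the event with ID `i`. -/
def updatePrepare [DecidableEq ID] (f : ℕ → ℕ) (s : State ID) (i : ID) : State ID :=
  match s.target i with
  | none => s
  | some r => { s with
      records := s.records.map fun x => if x.item.id = r then { x with sp := f x.sp } else x }

/-- Removal of an event from the prepare version. -/
def retreat [DecidableEq ID] (s : State ID) (e : Event ID α) : State ID :=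
  s.updatePrepare (fun n => n - 1) e.id

/-- Addition of an event, already applied before, to the prepare version. -/
def advance [DecidableEq ID] (s : State ID) (e : Event ID α) : State ID :=
  s.updatePrepare (fun n => n + 1) e.id

open Classical in
/-- Change of the prepare version to `V`: retreat the events that are only in the old version, in
the reverse of the topological sort order `E` of `G`, then advance the events that are only in the
new version, in the order `E`. -/
noncomputable def moveTo [DecidableEq ID] (G : Finset (Event ID α)) (E : List (Event ID α))
    (s : State ID) (V : Finset ID) : State ID :=
  let old := events G s.prepare
  let new := events G V
  let s₁ := (E.reverse.filter fun e => decide (e ∈ old ∧ e ∉ new)).foldl retreat s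
  let s₂ := (E.filter fun e => decide (e ∈ new ∧ e ∉ old)).foldl advance s₁
  { s₂ with prepare := V }

end State

/-- The position of the `i`-th record (from 0) that is visible in the prepare version, if any. -/
def visiblePos : ℕ → List (Record ID) → Option ℕ
  | _, [] => none
  | 0, x :: l => if x.sp = 1 then some 0 else (visiblePos 0 l).map (· + 1)
  | i + 1, x :: l => (visiblePos (if x.sp = 1 then i else i + 1) l).map (· + 1)

/-- The position directly after the first `i` records that are visible in the prepare version. -/
def insertionPos (i : ℕ) (l : List (Record ID)) : Option ℕ :=
  match i with
  | 0 => some 0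
  | i + 1 => (visiblePos i l).map (· + 1)

/-- The index in the effect version that corresponds to position `q` in the records. -/
def effectIndex (q : ℕ) (l : List (Record ID)) : ℕ :=
  (l.take q).countP fun x => !x.deleted

namespace State

/-- `apply(e)`, for an internal state whose prepare version is `e.parents`: the new internal state,
and the transformed operation (`none` is a no-op). Nothing happens if the index of the operation
does not exist. -/
noncomputable def apply [DecidableEq ID] (crdt : ListCRDT ID) (G : Finset (Event ID α))
    (s : State ID) (e : Event ID α) : State ID × Option (Op α) :=
  match e.op with
  | .insert i c =>
    match insertionPos i s.records with
    | none => ({ s with prepare := {e.id} }, none)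
    | some p =>
      let x : Item ID :=
        { id := .ins e.id
          originLeft := (s.records.take p).getLast?.map fun y => y.item.id
          originRight := ((s.records.drop p).find? fun y => decide (1 ≤ y.sp)).map
            fun y => y.item.id
          stamp := (events G e.parents).card + 1 }
      let q := crdt (s.records.map Record.item) x
      ({ records := insertAt q ⟨x, 1, false⟩ s.records
         target := Function.update s.target e.id (some (.ins e.id))
         prepare := {e.id} },
       some (.insert (effectIndex q s.records) c))
  | .delete i =>
    match visiblePos i s.records with
    | none => ({ s with prepare := {e.id} }, none)
    | some p =>
      match s.records[p]? with
      | none => ({ s with prepare := {e.id} }, none)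
      | some x =>
        ({ records := s.records.set p { x with sp := x.sp + 1, deleted := true }
           target := Function.update s.target e.id (some x.item.id)
           prepare := {e.id} },
         if x.deleted then none else some (.delete (effectIndex p s.records)))

end State

/-! ## Replay -/

/-- Application of the transformed operation of the event with ID `id` to the document state, the
sequence of the characters together with the IDs of the events that inserted them. -/
def applyOp (id : ID) (op : Option (Op α)) (doc : List (ID × α)) : List (ID × α) :=
  match op with
  | none => doc
  | some (.insert i c) => insertAt i (id, c) doc
  | some (.delete i) => doc.eraseIdx i

/-- A replica during the replay: the events processed so far, the document state, and the internal
state. -/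
structure Replica (ID α : Type*) where
  seen : Finset (Event ID α)
  doc : List (ID × α)
  state : State ID

open Classical in
/-- Processing of the next event `e` of the topological sort order `E` of `G`. If the version of the
events processed so far is critical in `G`, then the internal state can be discarded; this is done
at those critical versions that satisfy `discard`. -/
noncomputable def step [DecidableEq ID] (crdt : ListCRDT ID) (discard : Finset ID → Prop)
    (G : Finset (Event ID α)) (E : List (Event ID α)) (r : Replica ID α) (e : Event ID α) :
    Replica ID α :=
  let t := (r.state.moveTo G E e.parents).apply crdt G e
  let seen := insert e r.seen
  let doc := applyOp e.id t.2 r.doc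
  { seen := seen
    doc := doc
    state := if IsCritical G (version seen) ∧ discard (version seen) then
        State.ofPlaceholder (version seen) doc.length
      else t.1 }

/-- Replay of the event graph `G` in the topological sort order `E`. -/
noncomputable def replay [DecidableEq ID] (crdt : ListCRDT ID) (discard : Finset ID → Prop)
    (G : Finset (Event ID α)) (E : List (Event ID α)) : Replica ID α :=
  E.foldl (step crdt discard G E) ⟨∅, [], State.ofPlaceholder ∅ 0⟩

/-- Valid event graphs. The document version defined by the parents of an event is the result of
replaying the events that happened before it, in some topological sort order. -/
structure IsValid [DecidableEq ID] (crdt : ListCRDT ID) (discard : Finset ID → Prop)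
    (G : Finset (Event ID α)) : Prop where
  id_unique : ∀ a ∈ G, ∀ b ∈ G, a.id = b.id → a = b
  parents_mem : ∀ e ∈ G, ∀ p ∈ e.parents, ∃ a ∈ G, a ≠ e ∧ a.id = p
  acyclic : ∀ e ∈ G, ¬ HappenedBefore G e e
  index_exists : ∀ e ∈ G, ∃ E, IsTopologicalSort (events G e.parents) E ∧
    e.op.IndexExists (replay crdt discard (events G e.parents) E).doc.length

/-- Replay of `G` is deterministic: there is a topological sort order, and all of them lead to the
same document state and to the same internal state. Internal states are compared at the same prepare
version, whichever it is, because the replay leaves it at the last event of the sort order. -/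
def ReplayDeterministic [DecidableEq ID] (crdt : ListCRDT ID) (discard : Finset ID → Prop)
    (G : Finset (Event ID α)) : Prop :=
  (∃ E, IsTopologicalSort G E) ∧
  ∀ E E', IsTopologicalSort G E → IsTopologicalSort G E' →
    (replay crdt discard G E).doc = (replay crdt discard G E').doc ∧
    ∀ V : Finset ID, V ⊆ G.image Event.id →
      (replay crdt discard G E).state.moveTo G E V =
        (replay crdt discard G E').state.moveTo G E' V

end EgWalker

/-!
The replay is deterministic because everything it computes is a function of the set of events
processed so far, up to the choice of the prepare version.

*Prepare versions.* The state `sp` of a record counts the events of the prepare version that insert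
or delete the record (plus one for placeholders). This makes `moveTo` a closed formula in the target
map and the set `events G V`, independent of the sort order and of the previous prepare version
(`State.moveTo_eq_prepared`).

*What an event refers to.* After moving to the parents of an event `e`, the records with `1 ≤ sp`
are the placeholder and the insertions that happened before `e`. They alone determine the record
that `e` deletes, or the origins of the record that it inserts (`opTarget_view`, `opItem_view`), so
processing a concurrent event first makes no difference (`Inv.view_process`). They also form the
sequence that the list CRDT builds from the causal past of `e`: by convergence, the past of `e` may
be integrated first, and later insertions are then filtered out (`ListCRDT.IsHistory.filter_build`).
Hence the insertions since the internal state was last discarded form a history in the sense of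
`ListCRDT.IsHistory`, which is part of the invariant `Inv`.

*Exchange of concurrent events.* Any two topological sort orders are connected by exchanges of
adjacent concurrent events (`IsCausalList.rel_of_perm`). Between two concurrent events no version is
critical, so the internal state is kept, and both orders give the same items and targets; by
convergence they give the same records, and therefore the same document (`Inv.process_comm`).

*RGA* is convergent (`ListCRDT.rga_isConvergent`): two RGA insertions commute if neither item is the
left origin of the other one (`ListCRDT.rgaInsert_comm`), because their timestamps are comparable
and the order of timestamps is transitive.

An event whose index does not exist at its turn is a no-op without a target, and whether it exists
depends only on the view of the event; the same argument covers it.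
-/

namespace EgWalker

variable {ID α : Type*}

/-! ### Linear extensions of a causal order -/

/-- `l` lists a subset of `U` that is downward closed under `hb`, in an order that respects `hb`. -/
structure IsCausalList {β : Type*} (hb : β → β → Prop) (U : Set β) (l : List β) : Prop where
  nodup : l.Nodup
  subset : ∀ a ∈ l, a ∈ U
  closed : ∀ b ∈ l, ∀ a ∈ U, hb a b → a ∈ l
  causal : l.Pairwise fun a b => ¬ hb b a

namespace IsCausalList

variable {β : Type*} {hb : β → β → Prop} {U : Set β} {l l' : List β} {a b : β}

theorem of_append (h : IsCausalList hb U (l ++ l')) : IsCausalList hb U l where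
  nodup := (List.nodup_append.1 h.nodup).1
  subset a ha := h.subset a (by simp [ha])
  closed b hb' a ha hab := by
    rcases List.mem_append.1 (h.closed b (by simp [hb']) a ha hab) with h1 | h1
    · exact h1
    · exact absurd hab ((List.pairwise_append.1 h.causal).2.2 b hb' a h1)
  causal := (List.pairwise_append.1 h.causal).1

theorem notMem_of_concat (h : IsCausalList hb U (l ++ [a])) : a ∉ l := fun hal =>
  (List.nodup_append.1 h.nodup).2.2 a hal a (by simp) rfl

theorem not_before_of_concat (h : IsCausalList hb U (l ++ [a])) (hbl : b ∈ l) : ¬ hb a b :=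
  (List.pairwise_append.1 h.causal).2.2 b hbl a (by simp)

theorem of_perm (h : IsCausalList hb U l) (hp : l'.Perm l)
    (hc : l'.Pairwise fun a b => ¬ hb b a) : IsCausalList hb U l' where
  nodup := hp.nodup_iff.2 h.nodup
  subset a ha := h.subset a (hp.mem_iff.1 ha)
  closed b hb' a ha hab := hp.mem_iff.2 (h.closed b (hp.mem_iff.1 hb') a ha hab)
  causal := hc

/-- Any two causal lists of the same elements are connected by exchanges of adjacent concurrent
elements. -/
theorem rel_of_perm {rel : List β → List β → Prop} (irrefl : ∀ a ∈ U, ¬ hb a a)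
    (refl : ∀ l, rel l l) (trans : ∀ l₁ l₂ l₃, rel l₁ l₂ → rel l₂ l₃ → rel l₁ l₃)
    (concat : ∀ l l' a, IsCausalList hb U (l ++ [a]) → IsCausalList hb U (l' ++ [a]) →
      rel l l' → rel (l ++ [a]) (l' ++ [a]))
    (swap : ∀ l a b, IsCausalList hb U (l ++ [b] ++ [a]) → IsCausalList hb U (l ++ [a] ++ [b]) →
      rel (l ++ [b] ++ [a]) (l ++ [a] ++ [b]))
    (h : IsCausalList hb U l) (h' : IsCausalList hb U l') (hp : l.Perm l') : rel l l' := by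
  classical
  induction hn : l.length generalizing l l' with
  | zero =>
    obtain rfl := List.length_eq_zero_iff.1 hn
    obtain rfl := hp.nil_eq
    exact refl _
  | succ n ih =>
    rcases List.eq_nil_or_concat' l with rfl | ⟨l₀, a, rfl⟩
    · simp at hn
    rcases List.eq_nil_or_concat' l' with rfl | ⟨l₀', b, rfl⟩
    · simpa using hp.length_eq
    have hlen : l₀.length = n := by simpa using hn
    by_cases hab : a = b
    · subst hab
      exact concat _ _ _ h h'
        (ih h.of_append h'.of_append ((List.perm_append_right_iff _).1 hp) hlen)
    · -- Both `a` and `b` are maximal; `l₁` lists the elements other than these two.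
      have hbl : b ∈ l₀ := by
        have : b ∈ l₀ ++ [a] := hp.mem_iff.2 (by simp)
        simpa [Ne.symm hab] using this
      have hbmax : ∀ x ∈ l₀ ++ [a], ¬ hb b x := by
        intro x hx
        rcases List.mem_append.1 (hp.mem_iff.1 hx) with h1 | h1
        · exact h'.not_before_of_concat h1
        · rw [List.mem_singleton.1 h1]
          exact irrefl b (h'.subset b (by simp))
      obtain ⟨l₁, hl₁⟩ : ∃ l₁, l₀.erase b = l₁ := ⟨_, rfl⟩
      have hp₁ : (l₁ ++ [b]).Perm l₀ :=
        (List.perm_append_singleton b _).trans (hl₁ ▸ (List.perm_cons_erase hbl).symm)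
      have hp₂ : (l₁ ++ [a]).Perm l₀' := by
        refine (List.perm_append_right_iff [b]).1 (List.Perm.trans ?_ hp)
        refine List.Perm.trans ?_ ((List.perm_append_right_iff [a]).2 hp₁)
        simpa using (List.Perm.swap b a []).append_left l₁
      have hsub : ∀ x ∈ l₁, x ∈ l₀ := fun x hx => List.mem_of_mem_erase (hl₁ ▸ hx)
      have hc₁ : l₁.Pairwise fun a b => ¬ hb b a :=
        h.of_append.causal.sublist (hl₁ ▸ List.erase_sublist)
      have hcb : (l₁ ++ [b]).Pairwise fun a b => ¬ hb b a :=
        List.pairwise_append.2 ⟨hc₁, by simp, fun x hx y hy => by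
          rw [List.mem_singleton.1 hy]; exact hbmax x (by simp [hsub x hx])⟩
      have hca : (l₁ ++ [a]).Pairwise fun a b => ¬ hb b a :=
        List.pairwise_append.2 ⟨hc₁, by simp, fun x hx y hy => by
          rw [List.mem_singleton.1 hy]; exact h.not_before_of_concat (hsub x hx)⟩
      have hba : IsCausalList hb U (l₁ ++ [b] ++ [a]) :=
        h.of_perm ((List.perm_append_right_iff _).2 hp₁)
          (List.pairwise_append.2 ⟨hcb, by simp, fun x hx y hy => by
            rw [List.mem_singleton.1 hy]; exact h.not_before_of_concat (hp₁.mem_iff.1 hx)⟩)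
      have hab : IsCausalList hb U (l₁ ++ [a] ++ [b]) :=
        h'.of_perm ((List.perm_append_right_iff _).2 hp₂)
          (List.pairwise_append.2 ⟨hca, by simp, fun x hx y hy => by
            rw [List.mem_singleton.1 hy]; exact h'.not_before_of_concat (hp₂.mem_iff.1 hx)⟩)
      refine trans _ _ _ (concat _ _ _ h hba (ih h.of_append hba.of_append hp₁.symm hlen)) ?_
      refine trans _ _ _ (swap _ _ _ hba hab) (concat _ _ _ hab h' ?_)
      exact ih hab.of_append h'.of_append hp₂ (by
        rw [hp₂.length_eq]
        simpa [hlen] using hp.length_eq.symm)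

end IsCausalList

/-! ### Sequences built by a list CRDT -/


theorem insertAt_perm {β : Type*} (q : ℕ) (x : β) (l : List β) :
    (insertAt q x l).Perm (x :: l) := by
  have h := List.perm_middle (a := x) (l₁ := l.take q) (l₂ := l.drop q)
  rwa [List.take_append_drop] at h

@[simp]
theorem mem_insertAt {β : Type*} {q : ℕ} {x y : β} {l : List β} :
    y ∈ insertAt q x l ↔ y = x ∨ y ∈ l := by
  rw [(insertAt_perm q x l).mem_iff, List.mem_cons]

theorem map_insertAt {β γ : Type*} (f : β → γ) (q : ℕ) (x : β) (l : List β) :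
    (insertAt q x l).map f = insertAt q (f x) (l.map f) := by
  simp [insertAt, List.map_take, List.map_drop]

theorem filter_insertAt_of_neg {β : Type*} {p : β → Bool} {q : ℕ} {x : β} {l : List β}
    (h : p x = false) : (insertAt q x l).filter p = l.filter p := by
  rw [insertAt, List.filter_append, List.filter_cons_of_neg (by simp [h]), ← List.filter_append,
    List.take_append_drop]

theorem insertAt_succ_cons {β : Type*} (q : ℕ) (x z : β) (l : List β) :
    insertAt (q + 1) x (z :: l) = z :: insertAt q x l := rfl

theorem insertAt_takeWhile {β : Type*} (p : β → Bool) (x : β) (l : List β) :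
    insertAt (l.takeWhile p).length x l = l.takeWhile p ++ x :: l.dropWhile p := by
  induction l with
  | nil => simp [insertAt]
  | cons z l ih => by_cases hz : p z <;> simp_all [insertAt]

namespace ListCRDT

variable {crdt : ListCRDT ID} {n : ℕ} {S : Finset ID} {hb : ID → ID → Prop}
  {msg msg' : ID → Item ID} {L L' : List ID}

theorem build_concat (crdt : ListCRDT ID) (n : ℕ) (msg : ID → Item ID) (L : List ID) (i : ID) :
    crdt.build n msg (L ++ [i]) =
      insertAt (crdt (crdt.build n msg L) (msg i)) (msg i) (crdt.build n msg L) := by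
  simp [build]

theorem build_congr (h : ∀ i ∈ L, msg i = msg' i) : crdt.build n msg L = crdt.build n msg' L := by
  induction L using List.reverseRecOn with
  | nil => rfl
  | append_singleton L i ih =>
    rw [build_concat, build_concat, ih fun j hj => h j (by simp [hj]), h i (by simp)]

theorem build_perm (crdt : ListCRDT ID) (n : ℕ) (msg : ID → Item ID) (L : List ID) :
    (crdt.build n msg L).Perm (placeholderItems ID n ++ L.map msg) := by
  induction L using List.reverseRecOn with
  | nil => simp [build]
  | append_singleton L i ih =>
    rw [build_concat]
    refine (insertAt_perm _ _ _).trans ((ih.cons _).trans ?_)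
    rw [List.map_append, ← List.append_assoc]
    exact (List.perm_append_singleton _ _).symm

theorem map_id_build_perm (h : ∀ i ∈ L, (msg i).id = .ins i) :
    ((crdt.build n msg L).map Item.id).Perm
      ((List.range n).map RecordId.placeholder ++ L.map RecordId.ins) := by
  refine ((build_perm crdt n msg L).map _).trans (List.Perm.of_eq ?_)
  simp only [placeholderItems, List.map_append, List.map_map]
  congr 1
  exact List.map_congr_left fun i hi => h i hi

theorem nodup_map_id_build (h : ∀ i ∈ L, (msg i).id = .ins i) (hL : L.Nodup) :
    ((crdt.build n msg L).map Item.id).Nodup := by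
  rw [(map_id_build_perm h).nodup_iff, List.nodup_append]
  refine ⟨List.nodup_range.map fun a b h => by simpa using h,
    hL.map fun a b h => by simpa using h, ?_⟩
  intro a ha b hb
  obtain ⟨k, -, rfl⟩ := List.mem_map.1 ha
  obtain ⟨i, -, rfl⟩ := List.mem_map.1 hb
  simp

theorem placeholder_mem_build (h : ∀ i ∈ L, (msg i).id = .ins i) {k : ℕ} :
    .placeholder k ∈ (crdt.build n msg L).map Item.id ↔ k < n := by
  rw [(map_id_build_perm h).mem_iff]; simp

theorem ins_mem_build (h : ∀ i ∈ L, (msg i).id = .ins i) {i : ID} :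
    .ins i ∈ (crdt.build n msg L).map Item.id ↔ i ∈ L := by
  rw [(map_id_build_perm h).mem_iff]; simp

theorem filter_build_append {p : Item ID → Bool} (h : ∀ i ∈ L', p (msg i) = false) :
    (crdt.build n msg (L ++ L')).filter p = (crdt.build n msg L).filter p := by
  induction L' using List.reverseRecOn with
  | nil => simp
  | append_singleton L' i ih =>
    rw [← List.append_assoc, build_concat, filter_insertAt_of_neg (h i (by simp)),
      ih fun j hj => h j (by simp [hj])]

/-- For a convergent list CRDT, the elements of a sequence that were known to the event `e` form the
sequence that results from integrating only the insertions that happened before `e`. -/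
theorem IsHistory.filter_build (hc : crdt.IsConvergent) (h : IsHistory crdt n S hb msg)
    (hL : IsCausalOrder hb S L) {e : ID} {p : Item ID → Bool}
    (hp₀ : ∀ x ∈ placeholderItems ID n, p x = true) (hp : ∀ i ∈ S, p (msg i) = true ↔ hb i e) :
    (crdt.build n msg L).filter p = crdt.build n msg (L.filter fun i => p (msg i)) := by
  have hL' : IsCausalOrder hb S
      ((L.filter fun i => p (msg i)) ++ L.filter fun i => !p (msg i)) := by
    have hperm := List.filter_append_perm (fun i => p (msg i)) L
    refine ⟨hperm.nodup_iff.2 hL.nodup, fun i => hperm.mem_iff.trans (hL.mem_iff i), ?_⟩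
    refine List.pairwise_append.2 ⟨hL.causal.filter _, hL.causal.filter _, ?_⟩
    intro i hi j hj hji
    simp only [List.mem_filter, hL.mem_iff] at hi hj
    have := (hp j hj.1).2 (h.hb_trans _ _ _ hji ((hp i hi.1).1 hi.2))
    simp [this] at hj
  rw [hc n S hb msg h _ _ hL hL', filter_build_append (by simp), List.filter_eq_self]
  intro x hx
  rcases List.mem_append.1 ((build_perm _ _ _ _).mem_iff.1 hx) with h1 | h1
  · exact hp₀ x h1
  · obtain ⟨i, hi, rfl⟩ := List.mem_map.1 h1
    exact (List.mem_filter.1 hi).2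

theorem IsHistory.congr (h : IsHistory crdt n S hb msg) (hm : ∀ i ∈ S, msg i = msg' i) :
    IsHistory crdt n S hb msg' where
  hb_irrefl := h.hb_irrefl
  hb_trans := h.hb_trans
  id_eq i hi := hm i hi ▸ h.id_eq i hi
  stamp_pos i hi := hm i hi ▸ h.stamp_pos i hi
  stamp_lt i hi j hj := hm i hi ▸ hm j hj ▸ h.stamp_lt i hi j hj
  origins i hi := by
    obtain ⟨L, hL, l₁, l₂, h1, h2, h3⟩ := h.origins i hi
    refine ⟨L, hL, l₁, l₂, ?_, hm i hi ▸ h2, hm i hi ▸ h3⟩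
    rw [← h1]
    exact build_congr fun j hj => (hm j ((hL.mem_iff j).1 hj).1).symm

/-- A history can be extended by an insertion that happened before none of its insertions. -/
theorem IsHistory.insertion [DecidableEq ID] (h : IsHistory crdt n S hb msg) {e : ID}
    (hbe : ∀ i ∈ S, ¬ hb e i) (hid : (msg e).id = .ins e) (hpos : 0 < (msg e).stamp)
    (hlt : ∀ i ∈ S, hb i e → (msg i).stamp < (msg e).stamp)
    (horig : ∃ L, IsCausalOrder hb {j | j ∈ S ∧ hb j e} L ∧
      ∃ l₁ l₂, crdt.build n msg L = l₁ ++ l₂ ∧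
        (msg e).originLeft = l₁.getLast?.map Item.id ∧
        (msg e).originRight = l₂.head?.map Item.id) :
    IsHistory crdt n (insert e S) hb msg where
  hb_irrefl := h.hb_irrefl
  hb_trans := h.hb_trans
  id_eq i hi := by
    rcases Finset.mem_insert.1 hi with rfl | hi
    exacts [hid, h.id_eq i hi]
  stamp_pos i hi := by
    rcases Finset.mem_insert.1 hi with rfl | hi
    exacts [hpos, h.stamp_pos i hi]
  stamp_lt i hi j hj hij := by
    rcases Finset.mem_insert.1 hi with rfl | hi <;> rcases Finset.mem_insert.1 hj with rfl | hj
    · exact absurd hij (h.hb_irrefl _)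
    · exact absurd hij (hbe j hj)
    · exact hlt i ‹_› hij
    · exact h.stamp_lt i hi j hj hij
  origins i hi := by
    have hset : ∀ i, ¬ hb e i → {j | j ∈ insert e S ∧ hb j i} = {j | j ∈ S ∧ hb j i} := by
      intro i hei
      ext j
      simp only [Finset.mem_insert, Set.mem_ofPred_eq]
      constructor
      · rintro ⟨rfl | hj, hji⟩
        exacts [absurd hji hei, ⟨hj, hji⟩]
      · exact fun hj => ⟨Or.inr hj.1, hj.2⟩
    rcases Finset.mem_insert.1 hi with rfl | hi
    · rw [hset _ (h.hb_irrefl _)]; exact horig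
    · rw [hset _ (hbe i hi)]; exact h.origins i hi

/-! ### Convergence of RGA -/

section RGA

variable [LinearOrder ID]

/-- Insertion of `x` after the run of items with greater timestamps at the front of a list. -/
def rgaPlace (x : Item ID) (l : List (Item ID)) : List (Item ID) :=
  l.takeWhile (rgaLess x) ++ x :: l.dropWhile (rgaLess x)

/-- The insertion of RGA after the first item with the ID `o`. -/
def rgaAfter (o : RecordId ID) (x : Item ID) : List (Item ID) → List (Item ID)
  | [] => [x]
  | z :: l => if z.id = o then z :: rgaPlace x l else z :: rgaAfter o x l

/-- The insertion of RGA as a function of sequences. -/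
def rgaInsert (x : Item ID) (l : List (Item ID)) : List (Item ID) :=
  match x.originLeft with
  | none => rgaPlace x l
  | some o => rgaAfter o x l

theorem insertAt_rga (x : Item ID) (l : List (Item ID)) :
    insertAt (rga l x) x l = rgaInsert x l := by
  unfold rga rgaInsert
  cases x.originLeft with
  | none => simp [rgaPlace, insertAt_takeWhile]
  | some o =>
    simp only
    induction l with
    | nil => simp [insertAt, rgaAfter]
    | cons z l ih =>
      by_cases hz : z.id = o
      · simp [rgaAfter, hz, rgaPlace, List.findIdx_cons, Nat.add_comm 1, insertAt_succ_cons,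
          insertAt_takeWhile]
      · simp only [rgaAfter, hz, if_false, List.findIdx_cons, decide_false, cond_false]
        rw [← ih, Nat.add_right_comm, insertAt_succ_cons, List.drop_succ_cons]

theorem rgaLess_trans {x y z : Item ID} (h : rgaLess x y = true) (h' : rgaLess y z = true) :
    rgaLess x z = true := by
  simp only [rgaLess, Bool.or_eq_true, Bool.and_eq_true, decide_eq_true_eq] at *
  rcases h with h | ⟨h, h1⟩ <;> rcases h' with h' | ⟨h', h1'⟩
  · left; omega
  · left; omega
  · left; omega
  · refine Or.inr ⟨h.trans h', ?_⟩
    cases hx : x.id <;> cases hy : y.id <;> cases hz : z.id <;> simp_all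
    exact h1.trans h1'

theorem rgaLess_total {x y : Item ID} {i j : ID} (hx : x.id = .ins i) (hy : y.id = .ins j)
    (hij : i ≠ j) : rgaLess x y = !rgaLess y x := by
  rcases lt_trichotomy x.stamp y.stamp with h | h | h
  · simp [rgaLess, h, h.not_gt, h.ne']
  · rcases lt_or_gt_of_ne hij with h' | h' <;> simp [rgaLess, hx, hy, h, h', h'.not_gt]
  · simp [rgaLess, h, h.not_gt, h.ne']

theorem rgaPlace_cons (x z : Item ID) (l : List (Item ID)) :
    rgaPlace x (z :: l) = if rgaLess x z then z :: rgaPlace x l else x :: z :: l := by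
  by_cases h : rgaLess x z <;> simp [rgaPlace, h]

theorem rgaPlace_comm {x y : Item ID} (h : rgaLess x y = !rgaLess y x) (l : List (Item ID)) :
    rgaPlace x (rgaPlace y l) = rgaPlace y (rgaPlace x l) := by
  wlog hxy : rgaLess x y = true generalizing x y
  · exact (this (by simp [h]) (by simpa [h] using hxy)).symm
  have hyx : rgaLess y x = false := by simpa [hxy] using h
  induction l with
  | nil => simp [rgaPlace, hxy, hyx]
  | cons z l ih =>
    by_cases hyz : rgaLess y z = true
    · simp [rgaPlace_cons, hyz, rgaLess_trans hxy hyz, ih]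
    · by_cases hxz : rgaLess x z = true <;> simp [rgaPlace_cons, hyz, hxz, hxy, hyx]

theorem rgaPlace_rgaAfter_comm {x y : Item ID} {o : RecordId ID}
    (h : rgaLess x y = !rgaLess y x) (hyo : y.id ≠ o) {l : List (Item ID)}
    (ho : o ∈ l.map Item.id) : rgaPlace y (rgaAfter o x l) = rgaAfter o x (rgaPlace y l) := by
  induction l with
  | nil => simp at ho
  | cons z l ih =>
    by_cases hz : z.id = o
    · by_cases hyz : rgaLess y z = true <;>
        simp [rgaAfter, rgaPlace_cons, hz, hyz, hyo, rgaPlace_comm h]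
    · have ih := ih (by simpa [Ne.symm hz] using ho)
      by_cases hyz : rgaLess y z = true <;> simp [rgaAfter, rgaPlace_cons, hz, hyz, hyo, ih]

theorem rgaAfter_comm {x y : Item ID} {o o' : RecordId ID}
    (h : rgaLess x y = !rgaLess y x) (hyo : y.id ≠ o) (hxo : x.id ≠ o') {l : List (Item ID)}
    (ho : o ∈ l.map Item.id) (ho' : o' ∈ l.map Item.id) :
    rgaAfter o x (rgaAfter o' y l) = rgaAfter o' y (rgaAfter o x l) := by
  induction l with
  | nil => simp at ho
  | cons z l ih =>
    have h' : rgaLess y x = !rgaLess x y := by simp [h]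
    by_cases hz : z.id = o <;> by_cases hz' : z.id = o'
    · simp [rgaAfter, ← hz, ← hz', rgaPlace_comm h]
    · simp [rgaAfter, hz, rgaPlace_rgaAfter_comm h' hxo (by simpa [Ne.symm hz'] using ho'),
        show o ≠ o' from fun e => hz' (hz.trans e)]
    · simp [rgaAfter, hz', rgaPlace_rgaAfter_comm h hyo (by simpa [Ne.symm hz] using ho),
        show o' ≠ o from fun e => hz (hz'.trans e)]
    · simp [rgaAfter, hz, hz',
        ih (by simpa [Ne.symm hz] using ho) (by simpa [Ne.symm hz'] using ho')]

/-- RGA insertions commute if neither item is the origin of the other one. -/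
theorem rgaInsert_comm {x y : Item ID} (h : rgaLess x y = !rgaLess y x) {l : List (Item ID)}
    (hx : ∀ o, x.originLeft = some o → y.id ≠ o ∧ o ∈ l.map Item.id)
    (hy : ∀ o, y.originLeft = some o → x.id ≠ o ∧ o ∈ l.map Item.id) :
    rgaInsert x (rgaInsert y l) = rgaInsert y (rgaInsert x l) := by
  have h' : rgaLess y x = !rgaLess x y := by simp [h]
  unfold rgaInsert
  cases hox : x.originLeft <;> cases hoy : y.originLeft <;> simp only
  · exact rgaPlace_comm h l
  · exact rgaPlace_rgaAfter_comm h' (hy _ hoy).1 (hy _ hoy).2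
  · exact (rgaPlace_rgaAfter_comm h (hx _ hox).1 (hx _ hox).2).symm
  · exact rgaAfter_comm h (hx _ hox).1 (hy _ hoy).1 (hx _ hox).2 (hy _ hoy).2

/-- Concurrent RGA insertions commute, and linear extensions are connected by exchanges of
concurrent insertions. -/
theorem rga_isConvergent : (rga : ListCRDT ID).IsConvergent := by
  intro n S hb msg h L L' hL hL'
  have causal : ∀ {L}, IsCausalOrder hb S L → IsCausalList hb S L := fun hL =>
    ⟨hL.nodup, fun i hi => (hL.mem_iff i).1 hi, fun _ _ i hi _ => (hL.mem_iff i).2 hi, hL.causal⟩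
  -- The left origin of an insertion belongs to every sequence that contains its causal past.
  have origin : ∀ l i j, IsCausalList hb S (l ++ [i] ++ [j]) → ¬ hb i j → ∀ o,
      (msg j).originLeft = some o → (msg i).id ≠ o ∧ o ∈ (rga.build n msg l).map Item.id := by
    intro l i j hC hij o ho
    obtain ⟨K, hK, l₁, l₂, hb', hleft, -⟩ := h.origins j (hC.subset j (by simp))
    have hidK : ∀ k ∈ K, (msg k).id = .ins k := fun k hk => h.id_eq k ((hK.mem_iff k).1 hk).1
    have hidl : ∀ k ∈ l, (msg k).id = .ins k := fun k hk => h.id_eq k (hC.subset k (by simp [hk]))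
    have hoK : o ∈ (rga.build n msg K).map Item.id := by
      rw [ho] at hleft
      obtain ⟨x, hx, rfl⟩ := Option.map_eq_some_iff.1 hleft.symm
      rw [hb']
      exact List.mem_map_of_mem (List.mem_append_left _ (List.mem_of_getLast? hx))
    rw [h.id_eq i (hC.subset i (by simp))]
    cases o with
    | placeholder k =>
      rw [placeholder_mem_build hidK] at hoK
      exact ⟨by simp, (placeholder_mem_build hidl).2 hoK⟩
    | ins k =>
      rw [ins_mem_build hidK, hK.mem_iff] at hoK
      have hki : k ≠ i := fun e => hij (e ▸ hoK.2)
      have hkj : k ≠ j := fun e => h.hb_irrefl j (e ▸ hoK.2)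
      have := hC.closed j (by simp) k hoK.1 hoK.2
      exact ⟨by simpa using hki.symm, (ins_mem_build hidl).2 (by simpa [hki, hkj] using this)⟩
  refine IsCausalList.rel_of_perm (rel := fun l l' => rga.build n msg l = rga.build n msg l')
    (fun i _ => h.hb_irrefl i) (fun _ => rfl) (fun _ _ _ => Eq.trans) ?_ ?_ (causal hL) (causal hL')
    ((List.perm_ext_iff_of_nodup hL.nodup hL'.nodup).2 fun i =>
      (hL.mem_iff i).trans (hL'.mem_iff i).symm)
  · intro l l' i _ _ hll'
    simp only [build_concat, hll']
  · intro l i j hji hij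
    simp only [build_concat, insertAt_rga]
    have hne : i ≠ j := fun e => hij.notMem_of_concat (by simp [e])
    refine rgaInsert_comm (rgaLess_total (h.id_eq i (hij.subset i (by simp)))
      (h.id_eq j (hij.subset j (by simp))) hne) ?_ ?_
    · exact origin l j i hji (hij.not_before_of_concat (by simp))
    · exact origin l i j hij (hji.not_before_of_concat (by simp))

end RGA

end ListCRDT

/-! ### Event graphs -/

/-- The event graph `G` has unique IDs and is acyclic. -/
structure IsAcyclicGraph (G : Finset (Event ID α)) : Prop where
  id_unique : ∀ a ∈ G, ∀ b ∈ G, a.id = b.id → a = b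
  acyclic : ∀ e ∈ G, ¬ HappenedBefore G e e

/-- The happened-before relation of `G` on the IDs of events. -/
def IdBefore (G : Finset (Event ID α)) (i j : ID) : Prop :=
  ∃ a b, HappenedBefore G a b ∧ a.id = i ∧ b.id = j

section Graph

variable {G : Finset (Event ID α)} {a b e : Event ID α} {i j k : ID}

theorem HappenedBefore.mem_left (h : HappenedBefore G a b) : a ∈ G := by
  induction h using Relation.TransGen.head_induction_on with
  | single h => exact h.1
  | head h _ _ => exact h.1

theorem HappenedBefore.mem_right (h : HappenedBefore G a b) : b ∈ G := by
  induction h with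
  | single h => exact h.2.1
  | tail _ h _ => exact h.2.1

theorem HappenedBefore.mono {H : Finset (Event ID α)} (h : HappenedBefore H a b) (hHG : H ⊆ G) :
    HappenedBefore G a b :=
  Relation.TransGen.mono (fun _ _ h => ⟨hHG h.1, hHG h.2.1, h.2.2⟩) _ _ h

theorem mem_events {V : Finset ID} :
    a ∈ events G V ↔ a ∈ G ∧ (a.id ∈ V ∨ ∃ v ∈ G, v.id ∈ V ∧ HappenedBefore G a v) := by
  simp [events]

theorem mem_version : i ∈ version G ↔ ∃ e ∈ G, (¬ ∃ e' ∈ G, HappenedBefore G e e') ∧ e.id = i := by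
  simp [version, and_assoc]

theorem events_subset (V : Finset ID) : events G V ⊆ G := fun _ h => (mem_events.1 h).1

theorem mem_events_parents (hb : b ∈ G) : a ∈ events G b.parents ↔ HappenedBefore G a b := by
  rw [mem_events]
  constructor
  · rintro ⟨ha, h | ⟨v, hv, hvb, hav⟩⟩
    · exact .single ⟨ha, hb, h⟩
    · exact .tail hav ⟨hv, hb, hvb⟩
  · intro h
    refine ⟨h.mem_left, ?_⟩
    cases h with
    | single h => exact Or.inl h.2.2
    | tail h h' => exact Or.inr ⟨_, h'.1, h'.2.2, h⟩

theorem IsTopologicalSort.isCausalList {E : List (Event ID α)}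
    (h : IsTopologicalSort G E) : IsCausalList (HappenedBefore G) G E :=
  ⟨h.nodup, fun e he => (h.mem_iff e).1 he, fun _ _ e he _ => (h.mem_iff e).2 he, h.causal⟩

namespace IsAcyclicGraph

theorem idBefore_irrefl (hG : IsAcyclicGraph G) (i : ID) : ¬ IdBefore G i i := by
  rintro ⟨a, b, h, rfl, hb⟩
  obtain rfl := hG.id_unique _ h.mem_right _ h.mem_left hb
  exact hG.acyclic _ h.mem_left h

theorem idBefore_trans (hG : IsAcyclicGraph G) (h : IdBefore G i j) (h' : IdBefore G j k) :
    IdBefore G i k := by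
  obtain ⟨a, b, hab, rfl, rfl⟩ := h
  obtain ⟨b', c, hbc, hb, rfl⟩ := h'
  obtain rfl := hG.id_unique _ hab.mem_right _ hbc.mem_left hb.symm
  exact ⟨a, c, hab.trans hbc, rfl, rfl⟩

theorem idBefore_iff (hG : IsAcyclicGraph G) (ha : a ∈ G) (hb : b ∈ G) :
    IdBefore G a.id b.id ↔ HappenedBefore G a b := by
  constructor
  · rintro ⟨a', b', h, ha', hb'⟩
    rwa [← hG.id_unique _ h.mem_left _ ha ha', ← hG.id_unique _ h.mem_right _ hb hb']
  · exact fun h => ⟨a, b, h, rfl, rfl⟩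

/-- Logical timestamps respect the happened-before relation. -/
theorem card_events_parents_lt (hG : IsAcyclicGraph G) (h : HappenedBefore G a b) :
    (events G a.parents).card < (events G b.parents).card := by
  refine Finset.card_lt_card ((Finset.ssubset_iff_of_subset fun c hc => ?_).2 ⟨a, ?_, ?_⟩)
  · exact (mem_events_parents h.mem_right).2 (((mem_events_parents h.mem_left).1 hc).trans h)
  · exact (mem_events_parents h.mem_right).2 h
  · exact fun ha => hG.acyclic a h.mem_left ((mem_events_parents h.mem_left).1 ha)

theorem events_singleton [DecidableEq (Event ID α)] (hG : IsAcyclicGraph G) (he : e ∈ G) :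
    events G {e.id} = insert e (events G e.parents) := by
  ext a
  rw [Finset.mem_insert, mem_events_parents he]
  simp only [mem_events, Finset.mem_singleton]
  constructor
  · rintro ⟨ha, h | ⟨v, hv, hve, hav⟩⟩
    · exact Or.inl (hG.id_unique _ ha _ he h)
    · exact Or.inr (hG.id_unique _ hv _ he hve ▸ hav)
  · rintro (rfl | h)
    · exact ⟨he, Or.inl rfl⟩
    · exact ⟨h.mem_left, Or.inr ⟨e, he, rfl, h⟩⟩

/-- Sorting by the number of events that happened before gives a topological sort order. -/
theorem exists_isTopologicalSort (hG : IsAcyclicGraph G) : ∃ E, IsTopologicalSort G E := by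
  let r : Event ID α → Event ID α → Prop := fun a b =>
    (events G a.parents).card ≤ (events G b.parents).card
  have : DecidableRel r := fun _ _ => inferInstanceAs (Decidable (_ ≤ _))
  have : Std.Total r := ⟨fun _ _ => le_total _ _⟩
  have : IsTrans (Event ID α) r := ⟨fun _ _ _ => le_trans⟩
  refine ⟨G.toList.insertionSort r, (List.perm_insertionSort r _).nodup_iff.2 G.nodup_toList,
    fun e => by simp, ?_⟩
  refine (List.pairwise_insertionSort r G.toList).imp ?_
  intro a b hab hba
  exact absurd (hG.card_events_parents_lt hba) (not_lt.2 hab)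

/-- The version of the events processed so far is not critical if the last one of them and some
event not yet processed are concurrent. -/
theorem not_isCritical [DecidableEq (Event ID α)] (hG : IsAcyclicGraph G)
    {seen : Finset (Event ID α)} (hs : seen ⊆ G)
    (ha : a ∈ G) (hb : b ∈ G) (hbs : b ∉ seen) (hne : b ≠ a)
    (hseen_a : ∀ c ∈ seen, ¬ HappenedBefore G a c) (hseen_b : ∀ c ∈ seen, ¬ HappenedBefore G b c)
    (hab : ¬ HappenedBefore G a b) (hba : ¬ HappenedBefore G b a) :
    ¬ IsCritical G (version (insert a seen)) := by
  have hsub : insert a seen ⊆ G := Finset.insert_subset ha hs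
  have hmem : ∀ v ∈ G, v.id ∈ version (insert a seen) → v ∈ insert a seen := by
    intro v hv hvV
    obtain ⟨w, hw, -, hwv⟩ := mem_version.1 hvV
    rwa [← hG.id_unique _ (hsub hw) _ hv hwv]
  refine fun hc => hab (hc a ?_ b hb ?_)
  · refine mem_events.2 ⟨ha, Or.inl (mem_version.2 ⟨a, Finset.mem_insert_self _ _, ?_, rfl⟩)⟩
    rintro ⟨c, hc, hac⟩
    rcases Finset.mem_insert.1 hc with rfl | hc
    · exact hG.acyclic _ ha (hac.mono hsub)
    · exact hseen_a c hc (hac.mono hsub)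
  · intro hbV
    rcases (mem_events.1 hbV).2 with h | ⟨v, hv, hvV, hbv⟩
    · rcases Finset.mem_insert.1 (hmem b hb h) with h | h
      exacts [hne h, hbs h]
    · rcases Finset.mem_insert.1 (hmem v hv hvV) with rfl | h
      exacts [hba hbv, hseen_b v h hbv]

end IsAcyclicGraph

end Graph

/-! ### Changing the prepare version -/

section MoveTo

variable [DecidableEq ID]

/-- The state of a record to which no event has contributed. A placeholder starts as inserted, since
it stands for characters known to all events. -/
def baseState : RecordId ID → ℕ
  | .ins _ => 0
  | .placeholder _ => 1

/-- The state of a record in the prepare version that stands for the set `X` of events, if `t` maps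
events to the records that they insert or delete. Each event in `X` contributes one step. -/
def prepareState (t : ID → Option (RecordId ID)) (X : Finset (Event ID α)) (r : RecordId ID) : ℕ :=
  baseState r + (X.filter fun e => t e.id = some r).card

/-- The record `x` in the prepare version that stands for `X`. -/
def Record.prepared (t : ID → Option (RecordId ID)) (X : Finset (Event ID α)) (x : Record ID) :
    Record ID :=
  { x with sp := prepareState t X x.item.id }

variable {t : ID → Option (RecordId ID)} {G X : Finset (Event ID α)} {e : Event ID α}
  {R : List (Record ID)} {V : Finset ID}

theorem prepareState_insert [DecidableEq (Event ID α)] (he : e ∉ X) (r : RecordId ID) :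
    prepareState t (insert e X) r = prepareState t X r + if t e.id = some r then 1 else 0 := by
  rw [prepareState, prepareState, Finset.filter_insert]
  split_ifs
  · rw [Finset.card_insert_of_notMem (by simp [he])]; omega
  · simp

theorem prepareState_congr {t' : ID → Option (RecordId ID)} (h : ∀ e ∈ X, t e.id = t' e.id)
    (r : RecordId ID) : prepareState t X r = prepareState t' X r := by
  rw [prepareState, prepareState, Finset.filter_congr fun e he => by rw [h e he]]

theorem State.updatePrepare_mk (f : ℕ → ℕ) (i : ID) :
    (State.mk R t V).updatePrepare f i =
      ⟨R.map fun x => if t i = some x.item.id then { x with sp := f x.sp } else x, t, V⟩ := by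
  unfold updatePrepare
  cases h : t i with
  | none => simp [h]
  | some r => simp [h, eq_comm]

theorem State.advance_prepared [DecidableEq (Event ID α)] (he : e ∉ X) :
    (State.mk (R.map (Record.prepared t X)) t V).advance e =
      ⟨R.map (Record.prepared t (insert e X)), t, V⟩ := by
  simp only [advance, updatePrepare_mk, List.map_map, State.mk.injEq, and_true]
  refine List.map_congr_left fun x _ => ?_
  simp only [Function.comp, Record.prepared, prepareState_insert he]
  split_ifs <;> simp_all

theorem State.retreat_prepared [DecidableEq (Event ID α)] (he : e ∈ X) :
    (State.mk (R.map (Record.prepared t X)) t V).retreat e =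
      ⟨R.map (Record.prepared t (X.erase e)), t, V⟩ := by
  obtain ⟨Y, hY, rfl⟩ : ∃ Y, e ∉ Y ∧ insert e Y = X :=
    ⟨X.erase e, by simp, Finset.insert_erase he⟩
  simp only [retreat, updatePrepare_mk, List.map_map, State.mk.injEq, and_true,
    Finset.erase_insert hY]
  refine List.map_congr_left fun x _ => ?_
  simp only [Function.comp, Record.prepared, prepareState_insert hY]
  split_ifs <;> simp_all

theorem State.foldl_advance_prepared [DecidableEq (Event ID α)] (l : List (Event ID α))
    (hl : l.Nodup) (hX : ∀ e ∈ l, e ∉ X) :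
    l.foldl advance (State.mk (R.map (Record.prepared t X)) t V) =
      ⟨R.map (Record.prepared t (X ∪ l.toFinset)), t, V⟩ := by
  induction l generalizing X with
  | nil => simp
  | cons e l ih =>
    rw [List.nodup_cons] at hl
    rw [List.foldl_cons, advance_prepared (hX e (by simp)), ih hl.2, List.toFinset_cons,
      Finset.union_insert, Finset.insert_union]
    intro e' he'
    rw [Finset.mem_insert, not_or]
    exact ⟨fun h => hl.1 (h ▸ he'), hX e' (by simp [he'])⟩

theorem State.foldl_retreat_prepared [DecidableEq (Event ID α)] (l : List (Event ID α))
    (hl : l.Nodup) (hX : ∀ e ∈ l, e ∈ X) :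
    l.foldl retreat (State.mk (R.map (Record.prepared t X)) t V) =
      ⟨R.map (Record.prepared t (X \ l.toFinset)), t, V⟩ := by
  induction l generalizing X with
  | nil => simp
  | cons e l ih =>
    rw [List.nodup_cons] at hl
    rw [List.foldl_cons, retreat_prepared (hX e (by simp)), ih hl.2, List.toFinset_cons,
      Finset.erase_sdiff_comm, ← Finset.sdiff_insert]
    intro e' he'
    rw [Finset.mem_erase]
    exact ⟨fun h => hl.1 (h ▸ he'), hX e' (by simp [he'])⟩

/-- The records of `s` are in the states that its prepare version prescribes. -/
def State.IsPrepared (G : Finset (Event ID α)) (s : State ID) : Prop :=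
  ∀ x ∈ s.records, x.sp = prepareState s.target (events G s.prepare) x.item.id

/-- The state `s`, changed to the prepare version `V`. -/
noncomputable def State.prepared (G : Finset (Event ID α)) (s : State ID) (V : Finset ID) :
    State ID where
  records := s.records.map (Record.prepared s.target (events G V))
  target := s.target
  prepare := V

/-- The result of retreating and advancing depends neither on the sort order nor on the previous
prepare version. -/
theorem State.moveTo_eq_prepared {E : List (Event ID α)} (hE : IsTopologicalSort G E)
    {s : State ID} (hs : s.IsPrepared G) (V : Finset ID) : s.moveTo G E V = s.prepared G V := by
  classical
  obtain ⟨R, t, W⟩ := s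
  have hs : R.map (Record.prepared t (events G W)) = R :=
    (List.map_congr_left fun x hx => by rw [Record.prepared, ← hs x hx]; rfl).trans (List.map_id R)
  simp only [moveTo, prepared]
  generalize hl₁ : List.filter _ E.reverse = l₁
  generalize hl₂ : List.filter _ E = l₂
  have hm₁ : ∀ e, e ∈ l₁ ↔ e ∈ events G W ∧ e ∉ events G V := by
    subst hl₁
    simpa [hE.mem_iff] using fun e he _ => events_subset _ he
  have hm₂ : ∀ e, e ∈ l₂ ↔ e ∈ events G V ∧ e ∉ events G W := by
    subst hl₂
    simpa [hE.mem_iff] using fun e he _ => events_subset _ he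
  have hn₁ : l₁.Nodup := hl₁ ▸ (List.nodup_reverse.2 hE.nodup).filter _
  have hn₂ : l₂.Nodup := hl₂ ▸ hE.nodup.filter _
  have h₁ := foldl_retreat_prepared (R := R) (t := t) (V := W) l₁ hn₁ fun e he => ((hm₁ e).1 he).1
  have hX : events G W \ l₁.toFinset ∪ l₂.toFinset = events G V := by
    ext e
    simp only [Finset.mem_union, Finset.mem_sdiff, List.mem_toFinset, hm₁, hm₂]
    tauto
  rw [hs] at h₁
  rw [h₁, foldl_advance_prepared l₂ hn₂, hX]
  intro e he he'
  exact ((hm₂ e).1 he).2 (Finset.mem_sdiff.1 he').1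

end MoveTo

/-! ### Visible positions -/

section Positions

variable {R l₁ l₂ : List (Record ID)} {x : Record ID} {i p : ℕ}

theorem visiblePos_append (h₁ : l₁.countP (fun x => decide (x.sp = 1)) = i) (hx : x.sp = 1) :
    visiblePos i (l₁ ++ x :: l₂) = some l₁.length := by
  induction l₁ generalizing i with
  | nil =>
    obtain rfl : 0 = i := by simpa using h₁
    simp [visiblePos, hx]
  | cons y l₁ ih =>
    by_cases hy : y.sp = 1
    · obtain ⟨j, rfl⟩ : ∃ j, i = j + 1 := ⟨_, by rw [← h₁, List.countP_cons_of_pos (by simp [hy])]⟩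
      simp only [List.cons_append, visiblePos, hy, if_true]
      rw [ih (by simpa [hy] using h₁)]
      simp
    · have := ih (i := i) (by simpa [hy] using h₁)
      cases i <;> simp [visiblePos, hy, this]

theorem visiblePos_eq_none (h : R.countP (fun x => decide (x.sp = 1)) ≤ i) :
    visiblePos i R = none := by
  induction R generalizing i with
  | nil => cases i <;> rfl
  | cons y R ih =>
    by_cases hy : y.sp = 1
    · obtain ⟨j, rfl⟩ : ∃ j, i = j + 1 := by
        refine Nat.exists_eq_succ_of_ne_zero ?_
        rintro rfl
        simp [hy] at h
      simp only [visiblePos, hy, if_true]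
      rw [ih (by simpa [hy] using h)]
      rfl
    · have := ih (i := i) (by simpa [hy] using h)
      cases i <;> simp [visiblePos, hy, this]

theorem exists_split_of_lt_countP (h : i < R.countP fun x => decide (x.sp = 1)) :
    ∃ l₁ x l₂, R = l₁ ++ x :: l₂ ∧ x.sp = 1 ∧ l₁.countP (fun x => decide (x.sp = 1)) = i := by
  induction R generalizing i with
  | nil => simp at h
  | cons y R ih =>
    by_cases hy : y.sp = 1
    · cases i with
      | zero => exact ⟨[], y, R, rfl, hy, rfl⟩
      | succ i =>
        obtain ⟨l₁, x, l₂, rfl, hx, hi⟩ := ih (i := i) (by simpa [hy] using h)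
        exact ⟨y :: l₁, x, l₂, rfl, hx, by simp [hy, hi]⟩
    · obtain ⟨l₁, x, l₂, rfl, hx, hi⟩ := ih (i := i) (by simpa [hy] using h)
      exact ⟨y :: l₁, x, l₂, rfl, hx, by simp [hy, hi]⟩

/-- Either the `i`-th visible record does not exist, or the records split there. -/
theorem visiblePos_cases (i : ℕ) (R : List (Record ID)) :
    (visiblePos i R = none ∧ R.countP (fun x => decide (x.sp = 1)) ≤ i) ∨
      ∃ l₁ x l₂, R = l₁ ++ x :: l₂ ∧ x.sp = 1 ∧ l₁.countP (fun x => decide (x.sp = 1)) = i ∧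
        visiblePos i R = some l₁.length := by
  by_cases h : R.countP (fun x => decide (x.sp = 1)) ≤ i
  · exact Or.inl ⟨visiblePos_eq_none h, h⟩
  · obtain ⟨l₁, x, l₂, rfl, hx, hi⟩ := exists_split_of_lt_countP (not_le.1 h)
    exact Or.inr ⟨l₁, x, l₂, rfl, hx, hi, visiblePos_append hi hx⟩

/-- The part of the records that an event with the given prepare version refers to: the records that
have been inserted in the prepare version, without their states in the effect version. -/
def view (R : List (Record ID)) : List (Record ID) :=
  (R.filter fun x => decide (1 ≤ x.sp)).map fun x => { x with deleted := false }

theorem view_append : view (l₁ ++ l₂) = view l₁ ++ view l₂ := by simp [view]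

theorem view_cons (hx : 1 ≤ x.sp) : view (x :: R) = { x with deleted := false } :: view R := by
  simp [view, hx]

theorem countP_view (R : List (Record ID)) :
    (view R).countP (fun x => decide (x.sp = 1)) = R.countP fun x => decide (x.sp = 1) := by
  rw [view, List.countP_map, List.countP_filter]
  refine List.countP_congr fun x _ => ?_
  simp only [Function.comp, Bool.and_eq_true, decide_eq_true_eq]
  omega

theorem visiblePos_view_append (h₁ : l₁.countP (fun x => decide (x.sp = 1)) = i) (hx : x.sp = 1) :
    visiblePos i (view (l₁ ++ x :: l₂)) = some (view l₁).length := by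
  rw [view_append, view_cons hx.ge]
  exact visiblePos_append ((countP_view l₁).trans h₁) hx

/-- The record that the event `e` inserts or deletes, if its index exists. -/
def opTarget (R : List (Record ID)) (e : Event ID α) : Option (RecordId ID) :=
  match e.op with
  | .insert i _ => (insertionPos i R).map fun _ => .ins e.id
  | .delete i => ((visiblePos i R).bind fun p => R[p]?).map fun x => x.item.id

/-- The item of the record that the event `e` creates; the value for deletions is irrelevant. -/
noncomputable def opItem (G : Finset (Event ID α)) (R : List (Record ID)) (e : Event ID α) :
    Item ID :=
  let p := match e.op with
    | .insert i _ => (insertionPos i R).getD 0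
    | .delete _ => 0
  { id := .ins e.id
    originLeft := (R.take p).getLast?.map fun y => y.item.id
    originRight := ((R.drop p).find? fun y => decide (1 ≤ y.sp)).map fun y => y.item.id
    stamp := (events G e.parents).card + 1 }

theorem opTarget_view (R : List (Record ID)) (e : Event ID α) :
    opTarget (view R) e = opTarget R e := by
  unfold opTarget
  cases e.op with
  | insert i c =>
    cases i with
    | zero => rfl
    | succ i =>
      simp only [insertionPos]
      rcases visiblePos_cases i R with ⟨h, hi⟩ | ⟨l₁, x, l₂, rfl, hx, hi, h⟩
      · rw [h, visiblePos_eq_none (by rwa [countP_view])]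
      · rw [h, visiblePos_view_append hi hx]
        rfl
  | delete i =>
    simp only
    rcases visiblePos_cases i R with ⟨h, hi⟩ | ⟨l₁, x, l₂, rfl, hx, hi, h⟩
    · rw [h, visiblePos_eq_none (by rwa [countP_view])]; rfl
    · rw [h, visiblePos_view_append hi hx, view_append, view_cons hx.ge]
      simp

theorem find?_eq_head?_view (R : List (Record ID)) :
    ((R.find? fun y => decide (1 ≤ y.sp)).map fun y => y.item.id) =
      (view R).head?.map fun y => y.item.id := by
  rw [view, List.head?_map, List.head?_filter, Option.map_map]
  rfl

theorem view_view (R : List (Record ID)) : view (view R) = view R := by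
  simp [view, List.filter_map, Function.comp_def, List.filter_filter]

theorem find?_view (R : List (Record ID)) :
    (((view R).find? fun y => decide (1 ≤ y.sp)).map fun y => y.item.id) =
      (R.find? fun y => decide (1 ≤ y.sp)).map fun y => y.item.id := by
  rw [find?_eq_head?_view, find?_eq_head?_view, view_view]

theorem opItem_view (G : Finset (Event ID α)) (R : List (Record ID)) (e : Event ID α) :
    opItem G (view R) e = opItem G R e := by
  have hdrop : ∀ l : List (Record ID), l.drop (l.length + 1) = [] := fun l => by simp
  unfold opItem
  cases e.op with
  | insert i c =>
    cases i with
    | zero => simp [insertionPos, find?_view]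
    | succ i =>
      simp only [insertionPos]
      rcases visiblePos_cases i R with ⟨h, hi⟩ | ⟨l₁, x, l₂, rfl, hx, hi, h⟩
      · rw [h, visiblePos_eq_none (by rwa [countP_view])]; simp [find?_view]
      · rw [h, visiblePos_view_append hi hx, view_append, view_cons hx.ge]
        simp [List.take_append, List.drop_append, hdrop, find?_view]
  | delete i => simp [find?_view]

/-- The origins of a new record are neighbours in the view. -/
theorem exists_view_eq_append (G : Finset (Event ID α)) (R : List (Record ID)) {e : Event ID α}
    {c : α} (he : e.op = .insert i c) (hi : insertionPos i R ≠ none) :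
    ∃ l₁ l₂, (view R).map Record.item = l₁ ++ l₂ ∧
      (opItem G R e).originLeft = l₁.getLast?.map Item.id ∧
      (opItem G R e).originRight = l₂.head?.map Item.id := by
  unfold opItem
  rw [he]
  cases i with
  | zero =>
    refine ⟨[], _, rfl, by simp [insertionPos], ?_⟩
    simp only [insertionPos, Option.getD_some, List.drop_zero]
    rw [find?_eq_head?_view, List.head?_map, Option.map_map]
    rfl
  | succ i =>
    rcases visiblePos_cases i R with ⟨h, -⟩ | ⟨l₁, x, l₂, rfl, hx, -, h⟩
    · simp [insertionPos, h] at hi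
    · refine ⟨(view l₁).map Record.item ++ [x.item], (view l₂).map Record.item, ?_, ?_, ?_⟩
      · simp [view_append, view_cons hx.ge]
      · simp [insertionPos, h, List.take_append]
      · simp only [insertionPos, h, Option.map_some, Option.getD_some]
        rw [List.drop_append, List.drop_eq_nil_of_le (Nat.le_succ _), find?_eq_head?_view,
          List.head?_map, Option.map_map]
        simp [Function.comp_def]

end Positions

/-! ### Applying an event -/

theorem State.apply_cases [DecidableEq ID] (crdt : ListCRDT ID) (G : Finset (Event ID α))
    (s : State ID) (e : Event ID α) :
    (opTarget s.records e = none ∧ s.apply crdt G e = ({ s with prepare := {e.id} }, none)) ∨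
    (∃ i c q, e.op = .insert i c ∧ insertionPos i s.records ≠ none ∧
      opTarget s.records e = some (.ins e.id) ∧
      q = crdt (s.records.map Record.item) (opItem G s.records e) ∧
      s.apply crdt G e =
        ({ records := insertAt q ⟨opItem G s.records e, 1, false⟩ s.records
           target := Function.update s.target e.id (some (.ins e.id))
           prepare := {e.id} }, some (.insert (effectIndex q s.records) c))) ∨
    (∃ i l₁ x l₂, e.op = .delete i ∧ s.records = l₁ ++ x :: l₂ ∧ x.sp = 1 ∧
      opTarget s.records e = some x.item.id ∧
      s.apply crdt G e =
        ({ records := l₁ ++ { x with sp := x.sp + 1, deleted := true } :: l₂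
           target := Function.update s.target e.id (some x.item.id)
           prepare := {e.id} },
          if x.deleted then none else some (.delete (l₁.countP fun x => !x.deleted)))) := by
  obtain ⟨R, t, W⟩ := s
  unfold opTarget State.apply
  cases he : e.op with
  | insert i c =>
    simp only
    cases hp : insertionPos i R with
    | none => exact Or.inl ⟨rfl, rfl⟩
    | some p =>
      refine Or.inr (Or.inl ⟨i, c, _, rfl, by simp [hp], rfl, rfl, ?_⟩)
      simp [opItem, he, hp]
  | delete i =>
    simp only
    rcases visiblePos_cases i R with ⟨h, -⟩ | ⟨l₁, x, l₂, rfl, hx, -, h⟩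
    · left; simp [h]
    · refine Or.inr (Or.inr ⟨i, l₁, x, l₂, rfl, rfl, hx, ?_⟩)
      simp [h, effectIndex]

section Invariant

/-! ### The invariant of the replay -/

theorem map_item_id (R : List (Record ID)) :
    (R.map Record.item).map Item.id = R.map fun x => x.item.id := by
  simp

open Classical in
/-- The character that the insertion event with ID `i` inserts, as an element of documents. -/
noncomputable def insertedChar (G : Finset (Event ID α)) (i : ID) : Option (ID × α) :=
  if h : ∃ c, ∃ e ∈ G, e.id = i ∧ ∃ k, e.op = .insert k c then some (i, h.choose) else none

theorem IsAcyclicGraph.insertedChar_eq {G : Finset (Event ID α)} (hG : IsAcyclicGraph G)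
    {e : Event ID α} (he : e ∈ G) {k : ℕ} {c : α} (hop : e.op = .insert k c) :
    insertedChar G e.id = some (e.id, c) := by
  have h : ∃ c, ∃ e' ∈ G, e'.id = e.id ∧ ∃ k, e'.op = .insert k c := ⟨c, e, he, rfl, k, hop⟩
  rw [insertedChar, dif_pos h]
  obtain ⟨e', he', hid, k', hop'⟩ := h.choose_spec
  obtain rfl := hG.id_unique _ he' _ he hid
  rw [hop] at hop'
  injection hop' with _ hc
  rw [← hc]

/-- The element of the document that belongs to a record, if `base` is the document that the
placeholder stands for. -/
noncomputable def content (G : Finset (Event ID α)) (base : List (ID × α)) :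
    RecordId ID → Option (ID × α)
  | .ins i => insertedChar G i
  | .placeholder k => base[k]?

/-- The operation is a deletion. -/
def Op.IsDelete : Op α → Prop
  | .insert _ _ => False
  | .delete _ => True

variable [DecidableEq ID]

/-- The invariant of the replay. Here `base` is the document at the last version where the internal
state was discarded, and `msg` gives the items of the insertions since then. The records are those
that the list CRDT builds from these insertions, and the remaining fields say how the internal state
and the document follow from the records and from the targets of the events. -/
structure Inv (crdt : ListCRDT ID) (G : Finset (Event ID α)) (base : List (ID × α))
    (msg : ID → Item ID) (r : Replica ID α) : Prop where
  seen_subset : r.seen ⊆ G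
  history : ∃ L, r.state.records.map Record.item = crdt.build base.length msg L ∧
    crdt.IsHistory base.length L.toFinset (IdBefore G) msg ∧
    ListCRDT.IsCausalOrder (IdBefore G) {i | r.state.target i = some (.ins i)} L
  stamp : ∀ e ∈ G, r.state.target e.id = some (.ins e.id) →
    (msg e.id).stamp = (events G e.parents).card + 1
  target_seen : ∀ i k, r.state.target i = some k → ∃ e ∈ r.seen, e.id = i
  target_before : ∀ i j, r.state.target i = some (.ins j) → j = i ∨ IdBefore G j i
  deleted : ∀ x ∈ r.state.records, x.deleted = true ↔
    ∃ e ∈ r.seen, e.op.IsDelete ∧ r.state.target e.id = some x.item.id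
  doc : r.doc.map some =
    (r.state.records.filter fun x => !x.deleted).map fun x => content G base x.item.id
  prepared : r.state.IsPrepared G

namespace Inv

variable {crdt : ListCRDT ID} {G : Finset (Event ID α)} {base : List (ID × α)}
  {msg msg' : ID → Item ID} {r : Replica ID α} {e : Event ID α}

theorem congr (h : Inv crdt G base msg r)
    (hm : ∀ i, r.state.target i = some (.ins i) → msg i = msg' i) : Inv crdt G base msg' r where
  seen_subset := h.seen_subset
  history := by
    obtain ⟨L, hb, hh, hL⟩ := h.history
    have hm' : ∀ i ∈ L, msg i = msg' i := fun i hi => hm i ((hL.mem_iff i).1 hi)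
    exact ⟨L, hb.trans (ListCRDT.build_congr hm'), hh.congr (by simpa using hm'), hL⟩
  stamp e he ht := hm e.id ht ▸ h.stamp e he ht
  target_seen := h.target_seen
  target_before := h.target_before
  deleted := h.deleted
  doc := h.doc
  prepared := h.prepared

/-- The invariant holds when the internal state is empty or has just been discarded. -/
theorem ofPlaceholder (hG : IsAcyclicGraph G) {seen : Finset (Event ID α)} (hs : seen ⊆ G)
    (doc : List (ID × α)) (V : Finset ID) (msg : ID → Item ID) :
    Inv crdt G doc msg ⟨seen, doc, .ofPlaceholder V doc.length⟩ where
  seen_subset := hs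
  history := by
    refine ⟨[], by simp [State.ofPlaceholder, ListCRDT.build, Function.comp_def], ?_, by simp,
      ?_, by simp⟩
    · exact ⟨hG.idBefore_irrefl, fun _ _ _ => hG.idBefore_trans, by simp, by simp, by simp, by simp⟩
    · simp [State.ofPlaceholder]
  stamp := by simp [State.ofPlaceholder]
  target_seen := by simp [State.ofPlaceholder]
  target_before := by simp [State.ofPlaceholder]
  deleted := by simp [State.ofPlaceholder]
  doc := by
    simp only [State.ofPlaceholder]
    rw [List.filter_eq_self.2 (by simp)]
    refine List.ext_getElem (by simp [placeholderItems]) fun k h₁ h₂ => ?_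
    have h₁ : k < doc.length := by simpa using h₁
    simp [placeholderItems, content, h₁]
  prepared := by
    simp [State.ofPlaceholder, State.IsPrepared, placeholderItems, prepareState,
      baseState]

/-- The invariant does not depend on the prepare version. -/
theorem prepared_state (h : Inv crdt G base msg r) (V : Finset ID) :
    Inv crdt G base msg { r with state := r.state.prepared G V } where
  seen_subset := h.seen_subset
  history := by
    simpa [State.prepared, Function.comp_def, Record.prepared] using h.history
  stamp := h.stamp
  target_seen := h.target_seen
  target_before := h.target_before
  deleted x hx := by
    obtain ⟨y, hy, rfl⟩ := List.mem_map.1 hx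
    exact h.deleted y hy
  doc := by
    rw [h.doc]
    simp [State.prepared, List.filter_map, Function.comp_def, Record.prepared]
  prepared := by
    simp [State.IsPrepared, State.prepared, Record.prepared]

theorem target_eq_none (h : Inv crdt G base msg r) (he : e ∈ G) (hG : IsAcyclicGraph G)
    (hes : e ∉ r.seen) : r.state.target e.id = none := by
  by_contra hne
  obtain ⟨k, hk⟩ := Option.ne_none_iff_exists'.1 hne
  obtain ⟨e', he', hid⟩ := h.target_seen _ _ hk
  exact hes (hG.id_unique _ (h.seen_subset he') _ he hid ▸ he')

/-- No event refers to the insertion of an event that has not been processed. -/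
theorem target_ne_ins (h : Inv crdt G base msg r) (he : e ∈ G) (hG : IsAcyclicGraph G)
    (hes : e ∉ r.seen) (hmax : ∀ a ∈ r.seen, ¬ HappenedBefore G e a) (i : ID) :
    r.state.target i ≠ some (.ins e.id) := by
  intro hi
  rcases h.target_before _ _ hi with rfl | hb
  · simp [h.target_eq_none he hG hes] at hi
  · obtain ⟨a, ha, rfl⟩ := h.target_seen _ _ hi
    exact hmax a ha ((hG.idBefore_iff he (h.seen_subset ha)).1 hb)

theorem nodup_ids (h : Inv crdt G base msg r) :
    (r.state.records.map fun x => x.item.id).Nodup := by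
  obtain ⟨L, hb, hh, hL⟩ := h.history
  rw [← map_item_id, hb]
  exact ListCRDT.nodup_map_id_build (by simpa using hh.id_eq) hL.nodup

/-- The records of insertions that have been inserted in the version of the parents of `e` are those
of the insertions that happened before `e`: deletions of a record come after its insertion. -/
theorem one_le_prepareState_ins (h : Inv crdt G base msg r) (hG : IsAcyclicGraph G) (he : e ∈ G)
    {i : ID} (hi : r.state.target i = some (.ins i)) :
    1 ≤ prepareState r.state.target (events G e.parents) (.ins i) ↔ IdBefore G i e.id := by
  rw [prepareState, baseState, Nat.zero_add, Nat.one_le_iff_ne_zero, Finset.card_ne_zero]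
  constructor
  · rintro ⟨a, ha⟩
    obtain ⟨ha, hai⟩ := Finset.mem_filter.1 ha
    have hae := (hG.idBefore_iff (events_subset _ ha) he).2 ((mem_events_parents he).1 ha)
    rcases h.target_before _ _ hai with rfl | hia
    exacts [hae, hG.idBefore_trans hia hae]
  · intro hie
    obtain ⟨a, b, hab, rfl, hb⟩ := hie
    obtain rfl := hG.id_unique _ hab.mem_right _ he hb
    exact ⟨a, Finset.mem_filter.2 ⟨(mem_events_parents he).2 hab, hi⟩⟩

/-- The items of the view, as a filter on items that is independent of the current `sp`. -/
theorem view_map_item (h : Inv crdt G base msg r) :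
    (view r.state.records).map Record.item = (r.state.records.map Record.item).filter fun x =>
      decide (1 ≤ prepareState r.state.target (events G r.state.prepare) x.id) := by
  rw [view, List.map_map, List.filter_map]
  refine congrArg _ (List.filter_congr fun x hx => ?_)
  rw [h.prepared x hx]
  rfl

/-- The new item of an insertion extends the history. -/
theorem history_insertion (hc : crdt.IsConvergent) (hG : IsAcyclicGraph G)
    (h : Inv crdt G base msg r) (hprep : r.state.prepare = e.parents) (he : e ∈ G)
    (hmax : ∀ a ∈ r.seen, ¬ HappenedBefore G e a) {i : ℕ} {c : α}
    (hop : e.op = .insert i c) (hi : insertionPos i r.state.records ≠ none)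
    (hmsg : msg e.id = opItem G r.state.records e) {L : List ID}
    (hL : ListCRDT.IsCausalOrder (IdBefore G) {i | r.state.target i = some (.ins i)} L)
    (hb : r.state.records.map Record.item = crdt.build base.length msg L)
    (hh : crdt.IsHistory base.length L.toFinset (IdBefore G) msg) :
    crdt.IsHistory base.length (insert e.id L.toFinset) (IdBefore G) msg := by
  have htarget : ∀ j ∈ L, r.state.target j = some (.ins j) := fun j hj => (hL.mem_iff j).1 hj
  have hevent : ∀ j ∈ L, ∃ a ∈ r.seen, a.id = j := fun j hj => h.target_seen _ _ (htarget j hj)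
  have hL' : ListCRDT.IsCausalOrder (IdBefore G) (L.toFinset : Set ID) L :=
    ⟨hL.nodup, by simp, hL.causal⟩
  refine hh.insertion ?_ (by rw [hmsg]; rfl) (by rw [hmsg]; exact Nat.succ_pos _) ?_ ?_
  · intro j hj hej
    obtain ⟨a, ha, rfl⟩ := hevent j (List.mem_toFinset.1 hj)
    exact hmax a ha ((hG.idBefore_iff he (h.seen_subset ha)).1 hej)
  · intro j hj hje
    obtain ⟨a, ha, rfl⟩ := hevent j (List.mem_toFinset.1 hj)
    have haG := h.seen_subset ha
    rw [h.stamp a haG (htarget _ (List.mem_toFinset.1 hj)), hmsg]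
    exact Nat.succ_lt_succ (hG.card_events_parents_lt ((hG.idBefore_iff haG he).1 hje))
  · have hbefore : ∀ j ∈ L.toFinset, decide (1 ≤ prepareState r.state.target
        (events G r.state.prepare) (msg j).id) = true ↔ IdBefore G j e.id := by
      intro j hj
      rw [hh.id_eq j hj, decide_eq_true_eq, hprep]
      exact h.one_le_prepareState_ins hG he (htarget j (List.mem_toFinset.1 hj))
    obtain ⟨l₁, l₂, hl, hleft, hright⟩ := exists_view_eq_append G r.state.records hop hi
    refine ⟨L.filter fun j => decide (1 ≤ prepareState r.state.target
      (events G r.state.prepare) (msg j).id), ?_, l₁, l₂, ?_, hmsg ▸ hleft, hmsg ▸ hright⟩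
    · refine ⟨hL.nodup.filter _, fun j => ?_, hL.causal.filter _⟩
      rw [List.mem_filter, ← List.mem_toFinset]
      exact and_congr_right fun hj => hbefore j hj
    · rw [← hl, h.view_map_item, hb, hh.filter_build hc hL' ?_ hbefore]
      intro x hx
      obtain ⟨k, -, rfl⟩ := List.mem_map.1 hx
      simp [prepareState, baseState]

end Inv

/-! ### Preservation of the invariant -/

theorem filter_insertAt_of_pos {β : Type*} {p : β → Bool} {q : ℕ} {x : β} {l : List β}
    (h : p x = true) :
    (insertAt q x l).filter p = insertAt ((l.take q).countP p) x (l.filter p) := by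
  have h₁ : l.filter p = (l.take q).filter p ++ (l.drop q).filter p := by
    rw [← List.filter_append, List.take_append_drop]
  rw [insertAt, insertAt, List.filter_append, List.filter_cons_of_pos h, h₁,
    List.countP_eq_length_filter, List.take_left, List.drop_left]

theorem prepareState_update {G : Finset (Event ID α)} (hG : IsAcyclicGraph G) {e : Event ID α}
    (he : e ∈ G) (t : ID → Option (RecordId ID)) (v : Option (RecordId ID)) (k : RecordId ID) :
    prepareState (Function.update t e.id v) (events G {e.id}) k =
      prepareState t (events G e.parents) k + if v = some k then 1 else 0 := by
  classical
  have heX : e ∉ events G e.parents := fun h => hG.acyclic e he ((mem_events_parents he).1 h)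
  rw [hG.events_singleton he, prepareState_insert heX, Function.update_self,
    prepareState_congr (t' := t)]
  intro a ha
  refine Function.update_of_ne (fun h => heX ?_) _ _
  obtain rfl := hG.id_unique _ (events_subset _ ha) _ he h
  exact ha

namespace Inv

variable {crdt : ListCRDT ID} {G : Finset (Event ID α)} {base : List (ID × α)}
  {msg : ID → Item ID} {r : Replica ID α} {e : Event ID α}

/-- Applying an event whose index does not exist. -/
theorem apply_noop [DecidableEq (Event ID α)] (hG : IsAcyclicGraph G) (h : Inv crdt G base msg r)
    (hprep : r.state.prepare = e.parents) (he : e ∈ G) (hes : e ∉ r.seen) :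
    Inv crdt G base msg ⟨insert e r.seen, r.doc, { r.state with prepare := {e.id} }⟩ where
  seen_subset := Finset.insert_subset he h.seen_subset
  history := h.history
  stamp := h.stamp
  target_seen i k hi := by
    obtain ⟨a, ha, hai⟩ := h.target_seen i k hi
    exact ⟨a, Finset.mem_insert_of_mem ha, hai⟩
  target_before := h.target_before
  deleted x hx := by
    rw [h.deleted x hx]
    simp [h.target_eq_none he hG hes]
  doc := h.doc
  prepared x hx := by
    have := prepareState_update hG he r.state.target none x.item.id
    rw [← h.target_eq_none he hG hes, Function.update_eq_self] at this
    rw [h.prepared x hx, hprep]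
    simpa [h.target_eq_none he hG hes] using this.symm

theorem apply_insert [DecidableEq (Event ID α)] (hc : crdt.IsConvergent) (hG : IsAcyclicGraph G)
    (h : Inv crdt G base msg r) (hprep : r.state.prepare = e.parents) (he : e ∈ G)
    (hes : e ∉ r.seen) (hmax : ∀ a ∈ r.seen, ¬ HappenedBefore G e a) {i q : ℕ} {c : α}
    (hop : e.op = .insert i c) (hi : insertionPos i r.state.records ≠ none)
    (hmsg : msg e.id = opItem G r.state.records e)
    (hq : q = crdt (r.state.records.map Record.item) (opItem G r.state.records e)) :
    Inv crdt G base msg ⟨insert e r.seen, insertAt (effectIndex q r.state.records) (e.id, c) r.doc,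
      { records := insertAt q ⟨opItem G r.state.records e, 1, false⟩ r.state.records
        target := Function.update r.state.target e.id (some (.ins e.id))
        prepare := {e.id} }⟩ where
  seen_subset := Finset.insert_subset he h.seen_subset
  history := by
    obtain ⟨L, hb, hh, hL⟩ := h.history
    have hnone := h.target_eq_none he hG hes
    refine ⟨L ++ [e.id], ?_, ?_, ?_, ?_, ?_⟩
    · rw [ListCRDT.build_concat, map_insertAt, ← hb, hmsg, ← hq]
    · have := h.history_insertion hc hG hprep he hmax hop hi hmsg hL hb hh
      rwa [List.toFinset_append, List.toFinset_cons, List.toFinset_nil, Finset.union_comm,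
        Finset.insert_union, Finset.empty_union]
    · refine List.nodup_append.2 ⟨hL.nodup, by simp, ?_⟩
      intro j hj k hk hjk
      rw [hL.mem_iff] at hj
      simp only [List.mem_singleton] at hk
      subst hk hjk
      simp [hnone] at hj
    · intro j
      by_cases hj : j = e.id
      · simp [hj]
      · simpa [hj, Function.update_of_ne hj] using hL.mem_iff j
    · refine List.pairwise_append.2 ⟨hL.causal, by simp, fun j hj k hk hkj => ?_⟩
      rw [List.mem_singleton.1 hk] at hkj
      obtain ⟨a, ha, rfl⟩ := h.target_seen _ _ ((hL.mem_iff j).1 hj)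
      exact hmax a ha ((hG.idBefore_iff he (h.seen_subset ha)).1 hkj)
  stamp a ha hat := by
    by_cases hae : a.id = e.id
    · obtain rfl := hG.id_unique _ ha _ he hae
      rw [hmsg]; rfl
    · exact h.stamp a ha (by simpa [Function.update_of_ne hae] using hat)
  target_seen j k hj := by
    by_cases hje : j = e.id
    · exact ⟨e, Finset.mem_insert_self _ _, hje.symm⟩
    · obtain ⟨a, ha, hai⟩ := h.target_seen j k (by simpa [Function.update_of_ne hje] using hj)
      exact ⟨a, Finset.mem_insert_of_mem ha, hai⟩
  target_before j k hj := by
    by_cases hje : j = e.id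
    · subst hje
      left
      simpa [eq_comm] using hj
    · exact h.target_before j k (by simpa [Function.update_of_ne hje] using hj)
  deleted x hx := by
    have hold : ∀ k, (∃ a ∈ insert e r.seen, a.op.IsDelete ∧
        Function.update r.state.target e.id (some (.ins e.id)) a.id = some k) ↔
        ∃ a ∈ r.seen, a.op.IsDelete ∧ r.state.target a.id = some k := by
      intro k
      constructor
      · rintro ⟨a, ha, hdel, hat⟩
        rcases Finset.mem_insert.1 ha with rfl | ha
        · simp [hop, Op.IsDelete] at hdel
        · refine ⟨a, ha, hdel, ?_⟩
          rwa [Function.update_of_ne] at hat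
          exact fun hae => hes (hG.id_unique _ (h.seen_subset ha) _ he hae ▸ ha)
      · rintro ⟨a, ha, hdel, hat⟩
        refine ⟨a, Finset.mem_insert_of_mem ha, hdel, ?_⟩
        rwa [Function.update_of_ne]
        exact fun hae => hes (hG.id_unique _ (h.seen_subset ha) _ he hae ▸ ha)
    rw [hold]
    rcases mem_insertAt.1 hx with rfl | hx
    · simp only [Bool.false_eq_true, false_iff, not_exists, not_and]
      exact fun a _ _ => h.target_ne_ins he hG hes hmax a.id
    · exact h.deleted x hx
  doc := by
    rw [map_insertAt, h.doc, filter_insertAt_of_pos (by rfl), map_insertAt]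
    rw [show content G base (opItem G r.state.records e).id = some (e.id, c) from
      hG.insertedChar_eq he hop]
    rfl
  prepared x hx := by
    simp only
    rw [prepareState_update hG he]
    rcases mem_insertAt.1 hx with rfl | hx
    · simp [opItem, prepareState, baseState,
        h.target_ne_ins he hG hes hmax]
    · rw [h.prepared x hx, hprep, if_neg, Nat.add_zero]
      intro hxe
      obtain ⟨L, hb, hh, hL⟩ := h.history
      have : RecordId.ins e.id ∈ (r.state.records.map Record.item).map Item.id := by
        rw [map_item_id]
        exact List.mem_map.2 ⟨x, hx, (Option.some.inj hxe).symm⟩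
      rw [hb, ListCRDT.ins_mem_build (by simpa using hh.id_eq), hL.mem_iff] at this
      exact h.target_ne_ins he hG hes hmax _ this

theorem apply_delete [DecidableEq (Event ID α)] (hG : IsAcyclicGraph G)
    (h : Inv crdt G base msg r) (hprep : r.state.prepare = e.parents) (he : e ∈ G)
    (hes : e ∉ r.seen) {i : ℕ} (hop : e.op = .delete i) {l₁ l₂ : List (Record ID)} {x : Record ID}
    (hR : r.state.records = l₁ ++ x :: l₂) (hx : x.sp = 1) :
    Inv crdt G base msg ⟨insert e r.seen,
      if x.deleted then r.doc else r.doc.eraseIdx (l₁.countP fun x => !x.deleted),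
      { records := l₁ ++ { x with sp := x.sp + 1, deleted := true } :: l₂
        target := Function.update r.state.target e.id (some x.item.id)
        prepare := {e.id} }⟩ := by
  have hnodup := h.nodup_ids
  have hmem : ∀ y ∈ l₁ ++ { x with sp := x.sp + 1, deleted := true } :: l₂,
      y = { x with sp := x.sp + 1, deleted := true } ∨
        (y ∈ r.state.records ∧ y.item.id ≠ x.item.id) := by
    intro y hy
    rw [hR, List.map_append, List.map_cons, List.nodup_middle, List.nodup_cons,
      ← List.map_append] at hnodup
    have hne : ∀ y ∈ l₁ ++ l₂, y.item.id ≠ x.item.id := fun y hy hyx =>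
      hnodup.1 (List.mem_map.2 ⟨y, hy, hyx⟩)
    rcases List.mem_append.1 hy with hy | hy
    · exact Or.inr ⟨by simp [hR, hy], hne y (by simp [hy])⟩
    · rcases List.mem_cons.1 hy with hy | hy
      · exact Or.inl hy
      · exact Or.inr ⟨by simp [hR, hy], hne y (by simp [hy])⟩
  have hxR : x ∈ r.state.records := by simp [hR]
  obtain ⟨L, hb, hh, hL⟩ := h.history
  -- A record that is visible to `e` was inserted before `e`.
  have hbefore : ∀ j, x.item.id = .ins j → IdBefore G j e.id := by
    intro j hj
    have hjL : r.state.target j = some (.ins j) := by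
      have : RecordId.ins j ∈ (r.state.records.map Record.item).map Item.id := by
        rw [map_item_id]
        exact List.mem_map.2 ⟨x, hxR, hj⟩
      rwa [hb, ListCRDT.ins_mem_build (by simpa using hh.id_eq), hL.mem_iff] at this
    refine (h.one_le_prepareState_ins hG he hjL).1 ?_
    rw [← hprep, ← hj, ← h.prepared x hxR, hx]
  have hne_ins : x.item.id ≠ .ins e.id := fun hxe => hG.idBefore_irrefl _ (hbefore _ hxe)
  have hnone := h.target_eq_none he hG hes
  have hne : ∀ a ∈ r.seen, a.id ≠ e.id := fun a ha hae =>
    hes (hG.id_unique _ (h.seen_subset ha) _ he hae ▸ ha)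
  have hins : ∀ j, Function.update r.state.target e.id (some x.item.id) j = some (.ins j) ↔
      r.state.target j = some (.ins j) := by
    intro j
    by_cases hj : j = e.id
    · subst hj; simp [hnone, hne_ins]
    · rw [Function.update_of_ne hj]
  exact {
    seen_subset := Finset.insert_subset he h.seen_subset
    history := by
      refine ⟨L, ?_, hh, hL.nodup, fun j => (hL.mem_iff j).trans (hins j).symm, hL.causal⟩
      rw [← hb, hR]
      simp
    stamp := fun a ha hat => h.stamp a ha ((hins _).1 hat)
    target_seen := fun j k hj => by
      by_cases hje : j = e.id
      · exact ⟨e, Finset.mem_insert_self _ _, hje.symm⟩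
      · obtain ⟨a, ha, hai⟩ := h.target_seen j k (by simpa [Function.update_of_ne hje] using hj)
        exact ⟨a, Finset.mem_insert_of_mem ha, hai⟩
    target_before := fun j k hj => by
      by_cases hje : j = e.id
      · subst hje
        exact Or.inr (hbefore k (by simpa using hj))
      · exact h.target_before j k (by simpa [Function.update_of_ne hje] using hj)
    deleted := fun y hy => by
      rcases hmem y hy with rfl | ⟨hy, hyx⟩
      · simp only [true_iff]
        exact ⟨e, Finset.mem_insert_self _ _, by rw [hop]; trivial, Function.update_self ..⟩
      · rw [h.deleted y hy]
        constructor
        · rintro ⟨a, ha, hdel, hat⟩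
          exact ⟨a, Finset.mem_insert_of_mem ha, hdel, by simpa [Function.update_of_ne (hne a ha)]⟩
        · rintro ⟨a, ha, hdel, hat⟩
          rcases Finset.mem_insert.1 ha with rfl | ha
          · exact absurd (by simpa using hat.symm) hyx
          · exact ⟨a, ha, hdel, by simpa [Function.update_of_ne (hne a ha)] using hat⟩
    doc := by
      have hdoc := h.doc
      rw [hR] at hdoc
      by_cases hd : x.deleted = true
      · simpa [hd] using hdoc
      · simp only [hd, Bool.false_eq_true, if_false]
        rw [← List.eraseIdx_map, hdoc]
        simp [hd, List.countP_eq_length_filter, List.eraseIdx_append_of_length_le]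
    prepared := fun y hy => by
      simp only
      rw [prepareState_update hG he]
      rcases hmem y hy with rfl | ⟨hy, hyx⟩
      · simp [h.prepared x hxR, hprep]
      · simp [h.prepared y hy, hprep, hyx.symm] }

/-- Applying an event preserves the invariant, if `msg` gives the item that the event creates. -/
theorem apply [DecidableEq (Event ID α)] (hc : crdt.IsConvergent) (hG : IsAcyclicGraph G)
    (h : Inv crdt G base msg r) (hprep : r.state.prepare = e.parents) (he : e ∈ G)
    (hes : e ∉ r.seen) (hmax : ∀ a ∈ r.seen, ¬ HappenedBefore G e a)
    (hmsg : msg e.id = opItem G r.state.records e) :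
    Inv crdt G base msg ⟨insert e r.seen, applyOp e.id (r.state.apply crdt G e).2 r.doc,
      (r.state.apply crdt G e).1⟩ := by
  rcases State.apply_cases crdt G r.state e with ⟨-, happ⟩ | ⟨i, c, q, hop, hi, -, hq, happ⟩ |
    ⟨i, l₁, x, l₂, hop, hR, hx, -, happ⟩
  · rw [happ]
    exact h.apply_noop hG hprep he hes
  · rw [happ]
    exact h.apply_insert hc hG hprep he hes hmax hop hi hmsg hq
  · rw [happ]
    have := h.apply_delete hG hprep he hes hop hR hx
    by_cases hd : x.deleted = true
    · simpa only [hd, if_true, applyOp] using this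
    · simpa only [hd, Bool.false_eq_true, if_false, applyOp] using this

end Inv

end Invariant

section Replay

/-! ### Replicas up to the prepare version -/

/-- The replicas `r` and `r'` differ at most in their prepare versions. -/
structure Replica.Equiv (r r' : Replica ID α) : Prop where
  seen : r.seen = r'.seen
  doc : r.doc = r'.doc
  target : r.state.target = r'.state.target
  records : (r.state.records.map fun x => (x.item, x.deleted)) =
    r'.state.records.map fun x => (x.item, x.deleted)

namespace Replica.Equiv

variable {r r' r'' : Replica ID α}

theorem refl (r : Replica ID α) : r.Equiv r := ⟨rfl, rfl, rfl, rfl⟩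

theorem trans (h : r.Equiv r') (h' : r'.Equiv r'') : r.Equiv r'' :=
  ⟨h.seen.trans h'.seen, h.doc.trans h'.doc, h.target.trans h'.target, h.records.trans h'.records⟩

theorem prepared_eq [DecidableEq ID] (h : r.Equiv r') (G : Finset (Event ID α)) (V : Finset ID) :
    r.state.prepared G V = r'.state.prepared G V := by
  have hmap : ∀ (t : ID → Option (RecordId ID)) (R : List (Record ID)),
      R.map (Record.prepared t (events G V)) = (R.map fun x => (x.item, x.deleted)).map fun p =>
        ⟨p.1, prepareState t (events G V) p.1.id, p.2⟩ := by
    intro t R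
    rw [List.map_map]
    rfl
  rw [State.prepared, State.prepared, hmap, hmap, h.records, h.target]

end Replica.Equiv

open Classical in
/-- The internal state is discarded if the version is critical and satisfies `discard`. -/
noncomputable def finish (discard : Finset ID → Prop) (G : Finset (Event ID α))
    (r : Replica ID α) : Replica ID α :=
  { r with
    state := if IsCritical G (version r.seen) ∧ discard (version r.seen) then
        State.ofPlaceholder (version r.seen) r.doc.length
      else r.state }

theorem Replica.Equiv.finish {r r' : Replica ID α} (h : r.Equiv r') (discard : Finset ID → Prop)
    (G : Finset (Event ID α)) : (finish discard G r).Equiv (finish discard G r') := by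
  unfold EgWalker.finish
  rw [h.seen, h.doc]
  split_ifs
  · exact .refl _
  · exact ⟨rfl, rfl, h.target, h.records⟩

variable [DecidableEq ID] {crdt : ListCRDT ID} {G : Finset (Event ID α)} {base : List (ID × α)}
  {msg : ID → Item ID} {r r' : Replica ID α} {a b e : Event ID α}

/-- By convergence, a replica is determined up to the prepare version by the items and targets of
the events processed so far. -/
theorem Inv.equiv (hc : crdt.IsConvergent) (h : Inv crdt G base msg r) (h' : Inv crdt G base msg r')
    (hseen : r.seen = r'.seen) (htarget : r.state.target = r'.state.target) : r.Equiv r' := by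
  classical
  obtain ⟨L, hb, hh, hL⟩ := h.history
  obtain ⟨L', hb', hh', hL'⟩ := h'.history
  have hitems : r.state.records.map Record.item = r'.state.records.map Record.item := by
    rw [hb, hb']
    refine hc _ L.toFinset _ _ hh _ _ ⟨hL.nodup, by simp, hL.causal⟩ ⟨hL'.nodup, ?_, hL'.causal⟩
    intro i
    rw [hL'.mem_iff, ← htarget, ← hL.mem_iff]
    simp
  have hpairs : ∀ {r : Replica ID α}, Inv crdt G base msg r →
      (r.state.records.map fun x => (x.item, x.deleted)) =
        (r.state.records.map Record.item).map fun y => (y,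
          decide (∃ e ∈ r.seen, e.op.IsDelete ∧ r.state.target e.id = some y.id)) := by
    intro r h
    rw [List.map_map]
    refine List.map_congr_left fun x hx => ?_
    refine Prod.ext rfl (Bool.eq_iff_iff.2 ?_)
    exact (h.deleted x hx).trans decide_eq_true_iff.symm
  have hrecords : (r.state.records.map fun x => (x.item, x.deleted)) =
      r'.state.records.map fun x => (x.item, x.deleted) := by
    rw [hpairs h, hpairs h', hitems, hseen, htarget]
  have hdoc : ∀ R : List (Record ID),
      ((R.filter fun x => !x.deleted).map fun x => content G base x.item.id) =
        ((R.map fun x => (x.item, x.deleted)).filter fun p => !p.2).map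
          fun p => content G base p.1.id := by
    intro R
    simp [List.filter_map, Function.comp_def]
  refine ⟨hseen, (Option.some_injective _).list_map ?_, htarget, hrecords⟩
  rw [h.doc, h'.doc, hdoc, hdoc, hrecords]

/-! ### Processing an event -/

open Classical in
/-- The replica `r` after processing `e`, with its internal state kept. -/
noncomputable def process (crdt : ListCRDT ID) (G : Finset (Event ID α)) (r : Replica ID α)
    (e : Event ID α) : Replica ID α :=
  let t := (r.state.prepared G e.parents).apply crdt G e
  ⟨insert e r.seen, applyOp e.id t.2 r.doc, t.1⟩

theorem step_eq {E : List (Event ID α)} (hE : IsTopologicalSort G E) (discard : Finset ID → Prop)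
    (hr : r.state.IsPrepared G) (e : Event ID α) :
    step crdt discard G E r e = finish discard G (process crdt G r e) := by
  rw [step, State.moveTo_eq_prepared hE hr]
  rfl

theorem Replica.Equiv.process_eq (h : r.Equiv r') (e : Event ID α) :
    process crdt G r e = process crdt G r' e := by
  rw [process, process, h.prepared_eq, h.seen, h.doc]

theorem mem_process_seen : a ∈ (process crdt G r e).seen ↔ a = e ∨ a ∈ r.seen := by
  simp [process]

/-- The records in the version of the parents of `e`. -/
noncomputable def parentRecords (G : Finset (Event ID α)) (r : Replica ID α) (e : Event ID α) :
    List (Record ID) :=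
  (r.state.prepared G e.parents).records

theorem view_prepared (G : Finset (Event ID α)) (s : State ID) (V : Finset ID) :
    view (s.prepared G V).records =
      ((s.records.map Record.item).filter fun x =>
        decide (1 ≤ prepareState s.target (events G V) x.id)).map fun x =>
          ⟨x, prepareState s.target (events G V) x.id, false⟩ := by
  simp [view, State.prepared, List.filter_map, Function.comp_def, Record.prepared]
  rfl

namespace Inv

theorem finish (hG : IsAcyclicGraph G) (h : Inv crdt G base msg r) (discard : Finset ID → Prop) :
    ∃ base msg, Inv crdt G base msg (finish discard G r) := by
  unfold EgWalker.finish
  split_ifs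
  · exact ⟨r.doc, msg, ofPlaceholder hG h.seen_subset _ _ _⟩
  · exact ⟨base, msg, h⟩

theorem process (hc : crdt.IsConvergent) (hG : IsAcyclicGraph G) (h : Inv crdt G base msg r)
    (he : e ∈ G) (hes : e ∉ r.seen) (hmax : ∀ a ∈ r.seen, ¬ HappenedBefore G e a)
    (hmsg : msg e.id = opItem G (parentRecords G r e) e) :
    Inv crdt G base msg (process crdt G r e) := by
  classical
  exact (h.prepared_state e.parents).apply hc hG rfl he hes hmax hmsg

theorem process_target (hG : IsAcyclicGraph G) (h : Inv crdt G base msg r) (he : e ∈ G)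
    (hes : e ∉ r.seen) : (EgWalker.process crdt G r e).state.target =
      Function.update r.state.target e.id (opTarget (parentRecords G r e) e) := by
  unfold EgWalker.process parentRecords
  rcases State.apply_cases crdt G (r.state.prepared G e.parents) e with
    ⟨ht, happ⟩ | ⟨i, c, q, -, -, ht, -, happ⟩ | ⟨i, l₁, x, l₂, -, -, -, ht, happ⟩
  · rw [happ, ht, ← h.target_eq_none he hG hes, Function.update_eq_self]
    rfl
  · rw [happ, ht]
    rfl
  · rw [happ, ht]
    rfl

theorem process_items (crdt : ListCRDT ID) (G : Finset (Event ID α)) (r : Replica ID α)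
    (e : Event ID α) :
    (EgWalker.process crdt G r e).state.records.map Record.item =
        r.state.records.map Record.item ∨
      ∃ q x, x.id = .ins e.id ∧ (EgWalker.process crdt G r e).state.records.map Record.item =
        insertAt q x (r.state.records.map Record.item) := by
  have hitems : (r.state.prepared G e.parents).records.map Record.item =
      r.state.records.map Record.item := by
    simp [State.prepared, Function.comp_def, Record.prepared]
  unfold EgWalker.process
  rcases State.apply_cases crdt G (r.state.prepared G e.parents) e with
    ⟨-, happ⟩ | ⟨i, c, q, -, -, -, -, happ⟩ | ⟨i, l₁, x, l₂, -, hR, -, -, happ⟩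
  · left
    rw [happ]
    exact hitems
  · right
    refine ⟨q, opItem G (r.state.prepared G e.parents).records e, rfl, ?_⟩
    rw [happ, ← hitems]
    exact map_insertAt _ _ _ _
  · left
    rw [happ, ← hitems, hR]
    simp

/-- Processing an event does not change what an event that is not after it refers to. -/
theorem view_process (hG : IsAcyclicGraph G) (h : Inv crdt G base msg r) (ha : a ∈ G) (hb : b ∈ G)
    (has : a ∉ r.seen) (hmax : ∀ c ∈ r.seen, ¬ HappenedBefore G a c)
    (hab : ¬ HappenedBefore G a b) :
    view (parentRecords G (EgWalker.process crdt G r a) b) = view (parentRecords G r b) := by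
  have hne : ∀ c ∈ events G b.parents, c.id ≠ a.id := by
    intro c hc hca
    obtain rfl := hG.id_unique _ (events_subset _ hc) _ ha hca
    exact hab ((mem_events_parents hb).1 hc)
  have htarget : ∀ c ∈ events G b.parents,
      (EgWalker.process crdt G r a).state.target c.id = r.state.target c.id := by
    intro c hc
    rw [h.process_target hG ha has, Function.update_of_ne (hne c hc)]
  rw [parentRecords, parentRecords, view_prepared, view_prepared]
  simp only [prepareState_congr htarget]
  congr 1
  rcases process_items crdt G r a with hi | ⟨q, x, hx, hi⟩
  · rw [hi]
  · rw [hi, filter_insertAt_of_neg]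
    simp [hx, prepareState, baseState, h.target_ne_ins ha hG has hmax]

/-- Of two concurrent events, the second one gets the item and the target that it would get without
the first one. -/
theorem process_process (hc : crdt.IsConvergent) (hG : IsAcyclicGraph G)
    (h : Inv crdt G base msg r) (ha : a ∈ G) (hb : b ∈ G) (has : a ∉ r.seen) (hbs : b ∉ r.seen)
    (hmaxa : ∀ c ∈ r.seen, ¬ HappenedBefore G a c) (hmaxb : ∀ c ∈ r.seen, ¬ HappenedBefore G b c)
    (hne : b ≠ a) (hab : ¬ HappenedBefore G a b) (hba : ¬ HappenedBefore G b a)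
    (hmsga : msg a.id = opItem G (parentRecords G r a) a)
    (hmsgb : msg b.id = opItem G (parentRecords G r b) b) :
    Inv crdt G base msg (EgWalker.process crdt G (EgWalker.process crdt G r a) b) ∧
      (EgWalker.process crdt G (EgWalker.process crdt G r a) b).state.target =
        Function.update (Function.update r.state.target a.id (opTarget (parentRecords G r a) a))
          b.id (opTarget (parentRecords G r b) b) := by
  have h₁ := h.process hc hG ha has hmaxa hmsga
  have hbs₁ : b ∉ (EgWalker.process crdt G r a).seen := by simp [mem_process_seen, hne, hbs]
  have hview := h.view_process hG ha hb has hmaxa hab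
  constructor
  · refine h₁.process hc hG hb hbs₁ ?_ ?_
    · intro c hc
      rcases mem_process_seen.1 hc with rfl | hc
      exacts [hba, hmaxb c hc]
    · rw [← opItem_view, hview, opItem_view, hmsgb]
  · rw [h₁.process_target hG hb hbs₁, h.process_target hG ha has,
      ← opTarget_view (parentRecords G _ b), hview, opTarget_view]

/-- Two concurrent events can be processed in either order. -/
theorem process_comm (hc : crdt.IsConvergent) (hG : IsAcyclicGraph G)
    (h : Inv crdt G base msg r) (ha : a ∈ G) (hb : b ∈ G) (has : a ∉ r.seen) (hbs : b ∉ r.seen)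
    (hmaxa : ∀ c ∈ r.seen, ¬ HappenedBefore G a c) (hmaxb : ∀ c ∈ r.seen, ¬ HappenedBefore G b c)
    (hne : b ≠ a) (hab : ¬ HappenedBefore G a b) (hba : ¬ HappenedBefore G b a) :
    (EgWalker.process crdt G (EgWalker.process crdt G r a) b).Equiv
      (EgWalker.process crdt G (EgWalker.process crdt G r b) a) := by
  have hid : b.id ≠ a.id := fun hid => hne (hG.id_unique _ hb _ ha hid)
  -- The items of both events are known before either of them is processed.
  obtain ⟨msg', hmsg'⟩ : ∃ msg', msg' = Function.update
    (Function.update msg a.id (opItem G (parentRecords G r a) a)) b.id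
      (opItem G (parentRecords G r b) b) := ⟨_, rfl⟩
  have h' : Inv crdt G base msg' r := by
    refine h.congr fun i hi => ?_
    have hia : i ≠ a.id := by
      rintro rfl
      simp [h.target_eq_none ha hG has] at hi
    have hib : i ≠ b.id := by
      rintro rfl
      simp [h.target_eq_none hb hG hbs] at hi
    rw [hmsg', Function.update_of_ne hib, Function.update_of_ne hia]
  have hmsga : msg' a.id = opItem G (parentRecords G r a) a := by
    rw [hmsg', Function.update_of_ne hid.symm, Function.update_self]
  have hmsgb : msg' b.id = opItem G (parentRecords G r b) b := by rw [hmsg', Function.update_self]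
  have hab' := h'.process_process hc hG ha hb has hbs hmaxa hmaxb hne hab hba hmsga hmsgb
  have hba' := h'.process_process hc hG hb ha hbs has hmaxb hmaxa hne.symm hba hab hmsgb hmsga
  refine hab'.1.equiv hc hba'.1 ?_ ?_
  · ext c
    simp only [mem_process_seen]
    tauto
  · rw [hab'.2, hba'.2, Function.update_comm hid]

end Inv

/-! ### Determinism of the replay -/

/-- Processing the events in `L`; the sort order `E` only serves to change prepare versions. -/
noncomputable def run (crdt : ListCRDT ID) (discard : Finset ID → Prop) (G : Finset (Event ID α))
    (E L : List (Event ID α)) : Replica ID α :=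
  L.foldl (step crdt discard G E) ⟨∅, [], State.ofPlaceholder ∅ 0⟩

section Run

variable {discard : Finset ID → Prop} {E E' L L' : List (Event ID α)}

theorem run_concat (crdt : ListCRDT ID) (discard : Finset ID → Prop) (G : Finset (Event ID α))
    (E L : List (Event ID α)) (e : Event ID α) :
    run crdt discard G E (L ++ [e]) = step crdt discard G E (run crdt discard G E L) e := by
  simp [run]

/-- The invariant holds throughout the replay, for some document at the last discard. -/
theorem run_inv (hc : crdt.IsConvergent) (hG : IsAcyclicGraph G) (hE : IsTopologicalSort G E)
    (hL : IsCausalList (HappenedBefore G) G L) :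
    (∀ e, e ∈ (run crdt discard G E L).seen ↔ e ∈ L) ∧
      ∃ base msg, Inv crdt G base msg (run crdt discard G E L) := by
  induction L using List.reverseRecOn with
  | nil =>
    exact ⟨by simp [run], [], fun i => ⟨.ins i, none, none, 0⟩,
      Inv.ofPlaceholder hG (Finset.empty_subset G) [] ∅ _⟩
  | append_singleton L e ih =>
    obtain ⟨hseen, base, msg, h⟩ := ih hL.of_append
    have he : e ∈ G := hL.subset e (by simp)
    have hes : e ∉ (run crdt discard G E L).seen := by
      rw [hseen]; exact hL.notMem_of_concat
    rw [run_concat, step_eq hE discard h.prepared]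
    constructor
    · intro a
      refine (mem_process_seen (crdt := crdt) (G := G)).trans ?_
      rw [hseen]
      simp [or_comm]
    · have h' : Inv crdt G base
          (Function.update msg e.id (opItem G (parentRecords G (run crdt discard G E L) e) e))
          (run crdt discard G E L) := by
        refine h.congr fun i hi => (Function.update_of_ne ?_ _ _).symm
        rintro rfl
        simp [h.target_eq_none he hG hes] at hi
      refine (h'.process hc hG he hes ?_ (Function.update_self ..)).finish hG discard
      intro a ha
      exact hL.not_before_of_concat ((hseen a).1 ha)

/-- The order used to change prepare versions is irrelevant. -/
theorem run_congr (hc : crdt.IsConvergent) (hG : IsAcyclicGraph G) (hE : IsTopologicalSort G E)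
    (hE' : IsTopologicalSort G E') (hL : IsCausalList (HappenedBefore G) G L) :
    run crdt discard G E L = run crdt discard G E' L := by
  induction L using List.reverseRecOn with
  | nil => rfl
  | append_singleton L e ih =>
    have ih := ih hL.of_append
    obtain ⟨-, _, _, h⟩ := run_inv (discard := discard) hc hG hE hL.of_append
    rw [run_concat, run_concat, step_eq hE discard h.prepared,
      step_eq hE' discard (ih ▸ h.prepared), ih]

/-- The order in which events are processed is irrelevant. -/
theorem run_equiv (hc : crdt.IsConvergent) (hG : IsAcyclicGraph G) (hE : IsTopologicalSort G E)
    (hL : IsCausalList (HappenedBefore G) G L)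
    (hL' : IsCausalList (HappenedBefore G) G L') (hp : L.Perm L') :
    (run crdt discard G E L).Equiv (run crdt discard G E L') := by
  refine IsCausalList.rel_of_perm
    (rel := fun L L' => (run crdt discard G E L).Equiv (run crdt discard G E L'))
    hG.acyclic (fun _ => .refl _) (fun _ _ _ => .trans) ?_ ?_ hL hL' hp
  · intro L L' e hL hL' heq
    obtain ⟨-, _, _, h⟩ := run_inv (discard := discard) hc hG hE hL.of_append
    obtain ⟨-, _, _, h'⟩ := run_inv (discard := discard) hc hG hE hL'.of_append
    rw [run_concat, run_concat, step_eq hE discard h.prepared, step_eq hE discard h'.prepared,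
      heq.process_eq]
    exact .refl _
  · intro L a b hba hab
    obtain ⟨hseen, _, _, h⟩ := run_inv (discard := discard) hc hG hE hab.of_append.of_append
    have ha : a ∈ G := hab.subset a (by simp)
    have hb : b ∈ G := hab.subset b (by simp)
    have has : a ∉ (run crdt discard G E L).seen := by
      rw [hseen]; exact hab.of_append.notMem_of_concat
    have hbs : b ∉ (run crdt discard G E L).seen := by
      rw [hseen]; exact hba.of_append.notMem_of_concat
    have hmaxa : ∀ c ∈ (run crdt discard G E L).seen, ¬ HappenedBefore G a c := fun c hc =>
      hab.of_append.not_before_of_concat ((hseen c).1 hc)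
    have hmaxb : ∀ c ∈ (run crdt discard G E L).seen, ¬ HappenedBefore G b c := fun c hc =>
      hba.of_append.not_before_of_concat ((hseen c).1 hc)
    have hnba : ¬ HappenedBefore G b a := hab.not_before_of_concat (by simp)
    have hnab : ¬ HappenedBefore G a b := hba.not_before_of_concat (by simp)
    have hne : b ≠ a := fun e => hab.notMem_of_concat (by simp [e])
    -- The internal state is not discarded between two concurrent events.
    have hstep : ∀ {a b : Event ID α}, a ∈ G → b ∈ G → b ∉ (run crdt discard G E L).seen → b ≠ a →
        (∀ c ∈ (run crdt discard G E L).seen, ¬ HappenedBefore G a c) →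
        (∀ c ∈ (run crdt discard G E L).seen, ¬ HappenedBefore G b c) →
        ¬ HappenedBefore G a b → ¬ HappenedBefore G b a →
        run crdt discard G E (L ++ [a]) = process crdt G (run crdt discard G E L) a := by
      intro a b ha hb hbs hne hmaxa hmaxb hab hba
      classical
      have hcrit := hG.not_isCritical h.seen_subset ha hb hbs hne hmaxa hmaxb hab hba
      rw [run_concat, step_eq hE discard h.prepared, finish, if_neg]
      intro hcr
      refine hcrit ?_
      convert hcr.1
      simp [process]
    obtain ⟨-, _, _, h₁⟩ := run_inv (discard := discard) hc hG hE hab.of_append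
    obtain ⟨-, _, _, h₂⟩ := run_inv (discard := discard) hc hG hE hba.of_append
    rw [run_concat _ _ _ _ (L ++ [b]), run_concat _ _ _ _ (L ++ [a]),
      step_eq hE discard h₁.prepared, step_eq hE discard h₂.prepared,
      hstep ha hb hbs hne hmaxa hmaxb hnab hnba, hstep hb ha has hne.symm hmaxb hmaxa hnba hnab]
    exact (h.process_comm hc hG hb ha hbs has hmaxb hmaxa hne.symm hnba hnab).finish discard G

end Run

theorem replayDeterministic (hc : crdt.IsConvergent) (discard : Finset ID → Prop)
    (hG : IsAcyclicGraph G) : ReplayDeterministic crdt discard G := by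
  refine ⟨hG.exists_isTopologicalSort, fun E E' hE hE' => ?_⟩
  have hL := hE.isCausalList
  have hL' := hE'.isCausalList
  have heq : (replay crdt discard G E).Equiv (replay crdt discard G E') := by
    have := run_equiv (discard := discard) hc hG hE hL hL'
      ((List.perm_ext_iff_of_nodup hE.nodup hE'.nodup).2 fun e =>
        (hE.mem_iff e).trans (hE'.mem_iff e).symm)
    rw [run_congr hc hG hE hE' hL'] at this
    exact this
  obtain ⟨-, _, _, h⟩ := run_inv (discard := discard) hc hG hE hL
  obtain ⟨-, _, _, h'⟩ := run_inv (discard := discard) hc hG hE' hL'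
  refine ⟨heq.doc, fun V _ => ?_⟩
  exact (State.moveTo_eq_prepared hE h.prepared V).trans
    ((heq.prepared_eq G V).trans (State.moveTo_eq_prepared hE' h'.prepared V).symm)

end Replay

end EgWalker

theorem mainTheorem2 {ID α : Type*} [LinearOrder ID] :
    (∀ (crdt : EgWalker.ListCRDT ID), crdt.IsConvergent →
      ∀ (discard : Finset ID → Prop) (G : Finset (EgWalker.Event ID α)),
        EgWalker.IsValid crdt discard G → EgWalker.ReplayDeterministic crdt discard G) ∧
    (∀ (discard : Finset ID → Prop) (G : Finset (EgWalker.Event ID α)),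
      EgWalker.IsValid EgWalker.ListCRDT.rga discard G →
        EgWalker.ReplayDeterministic EgWalker.ListCRDT.rga discard G) :=
  ⟨fun _ hc discard _ hG => EgWalker.replayDeterministic hc discard ⟨hG.id_unique, hG.acyclic⟩,
    fun discard _ hG => EgWalker.replayDeterministic EgWalker.ListCRDT.rga_isConvergent discard
      ⟨hG.id_unique, hG.acyclic⟩⟩
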